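/- Let $G$ be the infinite $3$-regular tree and $v_1$ a node of $G$. Let the edges $e$ of $G$ carry independent random spreading times $\tau_e$, each exponentially distributed with mean $1$. A rumor starts at time $0$ at the source $v_1$, and every other node $v$ gets it at the time $\sum_e \tau_e$, where $e$ runs over the edges of the path from $v_1$ to $v$. Let $G_n$ be the subgraph induced on the first $n$ nodes that have the rumor. For a subtree $H$ of $G$ with $n$ nodes and a node $v$ of $H$, let $\Pr\{H \mid v\}$ be the probability that $G_n = H$ when the source is $v$. The maximum likelihood estimate $\hat V_n$ of the source, given $G_n$, is a node $v$ of $G_n$ that maximizes $\Pr\{G_n \mid v\}$, with ties broken uniformly at random. Then, for every integer $d \ge 1$, writing $d_G$ for the graph distance, $$\lim_{n\to\infty} \Pr\{d_G(\hat V_n, v_1) = d\} = 3\cdot 2^{d-1}(-1)^d\left(\frac14 + \sum_{l=1}^{d} (-1)^l\left(\frac{(\ln 2)^l}{l!} - 2 + \sum_{m=0}^{l}\frac{(\ln 2)^m}{m!}\right)\right).$$ -/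

import Mathlib

open MeasureTheory ProbabilityTheory Filter Topology

/-- Total spreading time along a walk, when the edge `e` has the spreading time `x e`. -/
def walkDelay {V : Type*} {G : SimpleGraph V} (x : G.edgeSet → ℝ) :
    {u v : V} → G.Walk u v → ℝ
  | _, _, .nil => 0
  | u, _, .cons (v := w) h p => x ⟨s(u, w), h⟩ + walkDelay x p

/-- Time at which `v` gets the rumor when it starts at time `0` at the source `s`: the shortest
total spreading time of a self-avoiding path from `s` to `v` (in a tree there is only one). -/
noncomputable def infectionTime {V : Type*} {G : SimpleGraph V} (x : G.edgeSet → ℝ)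
    (s v : V) : ℝ :=
  ⨅ p : G.Path s v, walkDelay x (p : G.Walk s v)

/-- The set of the first `n` infected nodes, that is, of those nodes before which fewer than `n`
nodes were infected. In a tree, the network of infected nodes is the subgraph induced on it. -/
def infectedNodes {V : Type*} {G : SimpleGraph V} (x : G.edgeSet → ℝ) (s : V) (n : ℕ) : Set V :=
  {v | {u | infectionTime x s u < infectionTime x s v}.encard < n}

/-- The event that the network of the first `n` infected nodes, with source `s`, has the
node set `A`. -/
def observedEvent {V Ω : Type*} {G : SimpleGraph V} (τ : G.edgeSet → Ω → ℝ) (s : V) (n : ℕ)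
    (A : Finset V) : Set Ω :=
  {ω | infectedNodes (fun e => τ e ω) s n = (A : Set V)}

/-- The maximum likelihood source candidates, given that the network of `n` infected nodes
has the node set `A`: those `v ∈ A` that maximize the probability of observing `A` under the
spreading model with source `v`. -/
def mlCandidates {V Ω : Type*} [MeasurableSpace Ω] {G : SimpleGraph V} (P : Measure Ω)
    (τ : G.edgeSet → Ω → ℝ) (n : ℕ) (A : Finset V) : Set V :=
  {v | v ∈ A ∧ ∀ w ∈ A, P (observedEvent τ w n A) ≤ P (observedEvent τ v n A)}

/-- `W` is the maximum likelihood estimate of the source from the network of `n` infected nodes,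
with ties broken uniformly at random: given that the network has the node set `A`, every
maximum likelihood candidate is selected with the same probability
(and then almost surely nothing else is selected). Here `s` is the true source. -/
structure IsMLEstimate {V Ω : Type*} [MeasurableSpace Ω] {G : SimpleGraph V} (P : Measure Ω)
    (τ : G.edgeSet → Ω → ℝ) (s : V) (n : ℕ) (W : Ω → V) : Prop where
  measurableSet_fiber : ∀ v, MeasurableSet {ω | W ω = v}
  prob_eq : ∀ (A : Finset V), ∀ v ∈ mlCandidates P τ n A,
    P (observedEvent τ s n A ∩ {ω | W ω = v})
      = P (observedEvent τ s n A) / ((mlCandidates P τ n A).ncard : ENNReal)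

/-! Because exponential delays are memoryless, given that the infected set is a subtree `A` with n
nodes, each of the n + 2 nodes next to `A` is equally likely to be infected next, whatever the shape
of `A` (`measure_observedEvent_inter_insert`). Two things follow.

Every infection order of n nodes has the same probability, so maximizing the likelihood means
maximizing the number of infection orders. When the source moves across an edge that splits `A` into
two parts, only a binomial coefficient changes (`growthCount_shuffle`), and so a likeliest source
has at most half of `A` beyond each of its edges (`two_mul_card_branch_le`). Hence, seen from the
true source s, the estimate lies in the branch of v if this branch has more than n/2 nodes, and only
if it has at least n/2.

Branch sizes evolve as a Pólya urn. At a neighbor of s the size is y with probability 2(n - y)/(n(n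
+ 1)); given a size x ≥ 1 at some u ≠ s, the size at a child of u is uniform on 0, …, x - 1
(`networkProb_branchCard_pair`). Iterating this, and adding the laws at consecutive depths, leaves
harmonic sums nested in (n/2, n], which tend to (ln 2)^d / d! (`tendsto_nestedSum_half`). This
yields the limit `tailLimit d` of the probability that a branch at distance d + 1 has more than half
of the nodes; a size of exactly n/2 has vanishing probability.

The 3·2^d branches at distance d + 1 are disjoint and together hold the nodes farther than d from s.
So the probability of an error larger than d tends to 3·2^d · `tailLimit d`, and the theorem is the
difference of two consecutive such limits. -/

namespace Rumor

/-! ### Rooted trees: parents, branches, children, spheres -/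

section Tree

variable {V : Type*} {G : SimpleGraph V}

/-- The neighbor of `x` that is closer to the root `r`. -/
noncomputable def parent (G : SimpleGraph V) (r x : V) : V :=
  open Classical in
  if h : ∃ y, G.Adj x y ∧ G.dist r x = G.dist r y + 1 then h.choose else x

/-- The nodes `x` such that `v` lies between the root `r` and `x`. -/
def branch (G : SimpleGraph V) (r v : V) : Set V :=
  {x | G.dist r x = G.dist r v + G.dist v x}

theorem exists_closer (hG : G.Connected) {r x : V} (hx : x ≠ r) :
    ∃ y, G.Adj x y ∧ G.dist r x = G.dist r y + 1 := by
  obtain ⟨p, hp⟩ := hG.exists_walk_length_eq_dist x r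
  cases p with
  | nil => exact absurd rfl hx
  | @cons _ w _ h q =>
    refine ⟨w, h, ?_⟩
    rw [SimpleGraph.Walk.length_cons] at hp
    have h1 := SimpleGraph.dist_le q
    have h2 : G.dist x r ≤ G.dist x w + G.dist w r := hG.dist_triangle
    rw [SimpleGraph.dist_eq_one_iff_adj.mpr h] at h2
    rw [SimpleGraph.dist_comm (u := r), SimpleGraph.dist_comm (u := r)]
    lia

theorem parent_spec (hG : G.IsTree) {r x : V} (hx : x ≠ r) :
    G.Adj x (parent G r x) ∧ G.dist r x = G.dist r (parent G r x) + 1 := by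
  have h := exists_closer hG.connected hx
  rw [parent, dif_pos h]
  exact h.choose_spec

/-- The default value of `parent` makes the root its own parent, so that sets closed under `parent`
need no exception at the root. -/
theorem parent_root (r : V) : parent G r r = r := by
  rw [parent, dif_neg]
  rintro ⟨y, -, h⟩
  simp at h

theorem parent_adj (hG : G.IsTree) {r x : V} (hx : x ≠ r) : G.Adj x (parent G r x) :=
  (parent_spec hG hx).1

theorem dist_parent (hG : G.IsTree) {r x : V} (hx : x ≠ r) :
    G.dist r x = G.dist r (parent G r x) + 1 :=
  (parent_spec hG hx).2

/-- Shortest walks to `y` and to `z`, prolonged to `x`, are paths from `r` to `x`; in a tree they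
coincide, and so do their last nodes before `x`. -/
theorem closer_unique (hG : G.IsTree) {r x y z : V} (hy : G.Adj x y) (hz : G.Adj x z)
    (hdy : G.dist r x = G.dist r y + 1) (hdz : G.dist r x = G.dist r z + 1) : y = z := by
  obtain ⟨p, hp⟩ := hG.connected.exists_walk_length_eq_dist r y
  obtain ⟨q, hq⟩ := hG.connected.exists_walk_length_eq_dist r z
  have hp' : (p.concat hy.symm).IsPath :=
    SimpleGraph.Walk.isPath_of_length_eq_dist _ (by rw [SimpleGraph.Walk.length_concat]; lia)
  have hq' : (q.concat hz.symm).IsPath :=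
    SimpleGraph.Walk.isPath_of_length_eq_dist _ (by rw [SimpleGraph.Walk.length_concat]; lia)
  have h := congrArg SimpleGraph.Walk.penultimate
    (congrArg Subtype.val ((hG.isAcyclic.subsingleton_path r x).elim ⟨_, hp'⟩ ⟨_, hq'⟩))
  simpa using h

theorem eq_parent (hG : G.IsTree) {r x y : V} (h : G.Adj x y)
    (hd : G.dist r x = G.dist r y + 1) : y = parent G r x := by
  have hx : x ≠ r := by rintro rfl; simp at hd
  exact closer_unique hG h (parent_adj hG hx) hd (dist_parent hG hx)

theorem adj_iff_parent (hG : G.IsTree) {r x y : V} :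
    G.Adj x y ↔ (x ≠ r ∧ y = parent G r x) ∨ (y ≠ r ∧ x = parent G r y) := by
  constructor
  · intro h
    rcases hG.dist_eq_dist_add_one_of_adj r h with h1 | h1
    · exact .inl ⟨by rintro rfl; simp at h1, eq_parent hG h h1⟩
    · exact .inr ⟨by rintro rfl; simp at h1, eq_parent hG h.symm h1⟩
  · rintro (⟨h, rfl⟩ | ⟨h, rfl⟩)
    · exact parent_adj hG h
    · exact (parent_adj hG h).symm

theorem parent_induction (hG : G.IsTree) (r : V) {p : V → Prop} (root : p r)
    (step : ∀ x, x ≠ r → p (parent G r x) → p x) (x : V) : p x := by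
  induction h : G.dist r x generalizing x with
  | zero => rw [hG.connected.dist_eq_zero_iff] at h; exact h ▸ root
  | succ n ih =>
    have hx : x ≠ r := by rintro rfl; simp at h
    exact step x hx (ih _ (by have := dist_parent hG hx; lia))

theorem self_mem_branch (r v : V) : v ∈ branch G r v := by simp [branch]

theorem root_mem_branch_iff (hG : G.IsTree) {r v : V} : r ∈ branch G r v ↔ v = r := by
  constructor
  · intro h
    simp only [branch, Set.mem_ofPred_eq, SimpleGraph.dist_self] at h
    exact ((hG.connected.dist_eq_zero_iff).mp (by lia)).symm
  · rintro rfl; exact self_mem_branch _ _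

theorem mem_branch_iff (hG : G.IsTree) {r v x : V} :
    x ∈ branch G r v ↔ x = v ∨ (x ≠ r ∧ parent G r x ∈ branch G r v) := by
  constructor
  · intro h
    by_cases hxv : x = v
    · exact .inl hxv
    refine .inr ?_
    -- A step from `x` towards `v` is also a step towards `r`, by the triangle inequality; so it
    -- leads to the parent.
    obtain ⟨y, hy, hd⟩ := exists_closer hG.connected hxv
    simp only [branch, Set.mem_ofPred_eq] at h ⊢
    have h1 : G.dist r y ≤ G.dist r v + G.dist v y := hG.connected.dist_triangle
    have h2 := hG.dist_eq_dist_add_one_of_adj r hy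
    have h3 : y = parent G r x := eq_parent hG hy (by lia)
    refine ⟨by rintro rfl; simp at h; lia, ?_⟩
    rw [← h3]; lia
  · rintro (rfl | ⟨hx, h⟩)
    · exact self_mem_branch _ _
    · simp only [branch, Set.mem_ofPred_eq] at h ⊢
      have h1 : G.dist r x ≤ G.dist r v + G.dist v x := hG.connected.dist_triangle
      have h2 := dist_parent hG hx
      have h3 := (parent_adj hG hx).symm.diff_dist_adj (u := v)
      lia

theorem parent_mem_branch (hG : G.IsTree) {r v x : V} (hx : x ∈ branch G r v) (hxv : x ≠ v) :
    parent G r x ∈ branch G r v :=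
  (((mem_branch_iff hG).mp hx).resolve_left hxv).2

theorem mem_branch_of_parent (hG : G.IsTree) {r v x : V} (h : parent G r x ∈ branch G r v) :
    x ∈ branch G r v := by
  by_cases hx : x = r
  · rw [hx, parent_root] at h
    rwa [hx]
  · exact (mem_branch_iff hG).mpr (.inr ⟨hx, h⟩)

theorem not_mem_branch_parent (hG : G.IsTree) {r v : V} (hv : v ≠ r) :
    parent G r v ∉ branch G r v := by
  intro h
  simp only [branch, Set.mem_ofPred_eq] at h
  have := dist_parent hG hv
  lia

/-- The only edge between a branch and its complement. -/
theorem eq_of_adj_of_mem_branch (hG : G.IsTree) {r v x y : V} (h : G.Adj x y)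
    (hx : x ∈ branch G r v) (hy : y ∉ branch G r v) : x = v ∧ y = parent G r v := by
  rcases (adj_iff_parent hG (r := r)).mp h with ⟨h1, rfl⟩ | ⟨h1, rfl⟩
  · have : x = v := by
      by_contra hxv
      exact hy (parent_mem_branch hG hx hxv)
    exact ⟨this, by rw [this]⟩
  · exact absurd (mem_branch_of_parent hG hx) hy

/-- On the way from `z` to `x`, the branch can only be left at `v`. The induction follows this way.
-/
theorem dist_add_of_not_mem_branch (hG : G.IsTree) {r v x z : V} (hx : x ∉ branch G r v)
    (hz : z ∈ branch G r v) : G.dist x z = G.dist x v + G.dist v z := by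
  refine le_antisymm hG.connected.dist_triangle ?_
  induction h : G.dist x z generalizing z with
  | zero =>
    rw [hG.connected.dist_eq_zero_iff] at h
    exact absurd (h ▸ hz) hx
  | succ n ih =>
    obtain ⟨y, hy, hd⟩ := exists_closer hG.connected (r := x) (x := z) (by rintro rfl; simp at h)
    by_cases hyb : y ∈ branch G r v
    · have h1 := ih hyb (by lia)
      have h2 := hy.symm.diff_dist_adj (u := v)
      lia
    · obtain ⟨rfl, -⟩ := eq_of_adj_of_mem_branch hG hy hz hyb
      simp [h]

theorem dist_add_of_mem_branch (hG : G.IsTree) {r v x z : V} (hx : x ∈ branch G r v)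
    (hz : z ∉ branch G r v) :
    G.dist x z = G.dist x (parent G r v) + G.dist (parent G r v) z := by
  refine le_antisymm hG.connected.dist_triangle ?_
  induction h : G.dist x z generalizing z with
  | zero =>
    rw [hG.connected.dist_eq_zero_iff] at h
    exact absurd (h ▸ hx) hz
  | succ n ih =>
    obtain ⟨y, hy, hd⟩ := exists_closer hG.connected (r := x) (x := z) (by rintro rfl; simp at h)
    by_cases hyb : y ∈ branch G r v
    · obtain ⟨-, rfl⟩ := eq_of_adj_of_mem_branch hG hy.symm hyb hz
      simp [h]
    · have h1 := ih hyb (by lia)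
      have h2 := hy.symm.diff_dist_adj (u := parent G r v)
      lia

/-- From a node outside a branch, some neighbor has the whole branch beyond it. -/
theorem exists_adj_branch_subset (hG : G.IsTree) {r v x : V} (hx : x ∉ branch G r v) :
    ∃ y, G.Adj x y ∧ branch G r v ⊆ branch G x y := by
  have hxv : x ≠ v := by rintro rfl; exact hx (self_mem_branch _ _)
  obtain ⟨y, hy, hd⟩ := exists_closer hG.connected hxv
  refine ⟨y, hy, fun z hz => ?_⟩
  have h1 := dist_add_of_not_mem_branch hG hx hz
  have h2 : G.dist y z ≤ G.dist y v + G.dist v z := hG.connected.dist_triangle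
  have h3 : G.dist x z ≤ G.dist x y + G.dist y z := hG.connected.dist_triangle
  have h4 := SimpleGraph.dist_eq_one_iff_adj.mpr hy
  have h5 := SimpleGraph.dist_comm (G := G) (u := v) (v := x)
  have h6 := SimpleGraph.dist_comm (G := G) (u := v) (v := y)
  simp only [branch, Set.mem_ofPred_eq]
  lia

/-- From a node in a branch, some neighbor has everything outside the branch beyond it. -/
theorem exists_adj_compl_branch_subset (hG : G.IsTree) {r v x : V} (hv : v ≠ r)
    (hx : x ∈ branch G r v) : ∃ y, G.Adj x y ∧ (branch G r v)ᶜ ⊆ branch G x y := by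
  have hxv : x ≠ parent G r v := by rintro rfl; exact not_mem_branch_parent hG hv hx
  obtain ⟨y, hy, hd⟩ := exists_closer hG.connected hxv
  refine ⟨y, hy, fun z hz => ?_⟩
  have h1 := dist_add_of_mem_branch hG hx hz
  have h2 : G.dist y z ≤ G.dist y (parent G r v) + G.dist (parent G r v) z :=
    hG.connected.dist_triangle
  have h3 : G.dist x z ≤ G.dist x y + G.dist y z := hG.connected.dist_triangle
  have h4 := SimpleGraph.dist_eq_one_iff_adj.mpr hy
  have h5 := SimpleGraph.dist_comm (G := G) (u := parent G r v) (v := x)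
  have h6 := SimpleGraph.dist_comm (G := G) (u := parent G r v) (v := y)
  simp only [branch, Set.mem_ofPred_eq]
  lia

/-- For a common node `x`, the way from `v` to `x` would pass through `w` and the way from `w` to
`x` through `v`; adding the two distance identities gives d(v, w) = 0. -/
theorem branch_disjoint (hG : G.IsTree) {r v w : V} (hvw : v ≠ w)
    (hd : G.dist r v = G.dist r w) : Disjoint (branch G r v) (branch G r w) := by
  have key : ∀ {a b : V}, a ≠ b → G.dist r a = G.dist r b → a ∉ branch G r b := by
    intro a b hab hd h
    simp only [branch, Set.mem_ofPred_eq] at h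
    exact hab (hG.connected.dist_eq_zero_iff.mp (by lia)).symm
  rw [Set.disjoint_left]
  intro x hv hw
  have h1 := dist_add_of_not_mem_branch hG (key hvw.symm hd.symm) hv
  have h2 := dist_add_of_not_mem_branch hG (key hvw hd) hw
  have h3 := hG.connected.pos_dist_of_ne hvw
  have h4 := SimpleGraph.dist_comm (G := G) (u := v) (v := w)
  lia

theorem exists_mem_branch_of_le_dist (hG : G.IsTree) {r x : V} {d : ℕ} (h : d ≤ G.dist r x) :
    ∃ v, G.dist r v = d ∧ x ∈ branch G r v := by
  induction x using parent_induction hG r with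
  | root =>
    rw [SimpleGraph.dist_self] at h
    exact ⟨r, by rw [SimpleGraph.dist_self]; lia, self_mem_branch _ _⟩
  | step x hx ih =>
    rcases h.eq_or_lt with h | h
    · exact ⟨x, h.symm, self_mem_branch _ _⟩
    · obtain ⟨v, hv, hxv⟩ := ih (by have := dist_parent hG hx; lia)
      exact ⟨v, hv, mem_branch_of_parent hG hxv⟩

/-- Both ends of an edge see the same bipartition of the tree. This allows the comparison of the two
ends as sources. -/
theorem branch_compl_of_adj (hG : G.IsTree) {u w : V} (h : G.Adj u w) :
    branch G w u = (branch G u w)ᶜ := by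
  ext x
  simp only [branch, Set.mem_ofPred_eq, Set.mem_compl_iff]
  have h1 := SimpleGraph.dist_eq_one_iff_adj.mpr h
  have h2 := SimpleGraph.dist_eq_one_iff_adj.mpr h.symm
  have h3 := hG.dist_eq_dist_add_one_of_adj x h
  rw [h1, h2, SimpleGraph.dist_comm (u := u), SimpleGraph.dist_comm (u := w)]
  lia

theorem parent_of_adj_root (hG : G.IsTree) {r v : V} (h : G.Adj r v) : parent G r v = r :=
  (eq_parent hG h.symm (by simpa using SimpleGraph.dist_eq_one_iff_adj.mpr h)).symm

/-! ### Children -/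

variable [G.LocallyFinite]

theorem neighborFinset_filter_card (hG : G.IsTree) (hdeg : G.IsRegularOfDegree 3) [DecidableEq V]
    (r x : V) :
    ((G.neighborFinset x).filter (fun y => y ≠ r ∧ parent G r y = x)).card =
      if x = r then 3 else 2 := by
  have h3 : (G.neighborFinset x).card = 3 := by
    rw [SimpleGraph.card_neighborFinset_eq_degree]; exact hdeg x
  split_ifs with hx
  · subst hx
    rw [Finset.filter_true_of_mem, h3]
    intro y hy
    rw [SimpleGraph.mem_neighborFinset] at hy
    exact ⟨hy.ne', parent_of_adj_root hG hy⟩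
  · have : (G.neighborFinset x).filter (fun y => y ≠ r ∧ parent G r y = x)
        = (G.neighborFinset x).erase (parent G r x) := by
      ext y
      simp only [Finset.mem_filter, SimpleGraph.mem_neighborFinset, Finset.mem_erase]
      constructor
      · rintro ⟨h, hy, rfl⟩
        refine ⟨?_, h⟩
        rintro h1
        have h2 := dist_parent hG hy
        have h3 := dist_parent hG hx
        rw [← h1] at h3
        lia
      · rintro ⟨h, h1⟩
        refine ⟨h1, ?_⟩
        rcases (adj_iff_parent hG (r := r)).mp h1 with ⟨-, h2⟩ | ⟨h2, h3⟩
        · exact absurd h2 h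
        · exact ⟨h2, h3.symm⟩
    rw [this, Finset.card_erase_of_mem, h3]
    rw [SimpleGraph.mem_neighborFinset]
    exact parent_adj hG hx

/-- The children of `x` in the tree with root `r`. -/
noncomputable def children (G : SimpleGraph V) [G.LocallyFinite] (r x : V) : Finset V :=
  open Classical in (G.neighborFinset x).filter (fun y => y ≠ r ∧ parent G r y = x)

theorem mem_children (hG : G.IsTree) {r x y : V} :
    y ∈ children G r x ↔ y ≠ r ∧ parent G r y = x := by
  classical
  rw [children, Finset.mem_filter, SimpleGraph.mem_neighborFinset, and_iff_right_iff_imp]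
  rintro ⟨h, rfl⟩
  exact (parent_adj hG h).symm

theorem card_children [DecidableEq V] (hG : G.IsTree) (hdeg : G.IsRegularOfDegree 3) (r x : V) :
    (children G r x).card = if x = r then 3 else 2 := by
  rw [← neighborFinset_filter_card hG hdeg r x, children]
  congr!

theorem children_disjoint (hG : G.IsTree) (r : V) {x y : V} (h : x ≠ y) :
    Disjoint (children G r x) (children G r y) := by
  rw [Finset.disjoint_left]
  intro z hx hy
  rw [mem_children hG] at hx hy
  exact h (hx.2.symm.trans hy.2)

/-- In the infinite 3-regular tree, there are `3 * 2 ^ (d - 1)` nodes at distance `d ≥ 1`. -/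
theorem exists_sphere (hG : G.IsTree) (hdeg : G.IsRegularOfDegree 3) (r : V) (d : ℕ) :
    ∃ S : Finset V, (∀ x, x ∈ S ↔ G.dist r x = d + 1) ∧ S.card = 3 * 2 ^ d := by
  classical
  induction d with
  | zero =>
    refine ⟨G.neighborFinset r, fun x => ?_, ?_⟩
    · rw [SimpleGraph.mem_neighborFinset, zero_add, SimpleGraph.dist_eq_one_iff_adj]
    · rw [SimpleGraph.card_neighborFinset_eq_degree]; exact hdeg r
  | succ d ih =>
    obtain ⟨S, hS, hc⟩ := ih
    refine ⟨S.biUnion (children G r), fun x => ?_, ?_⟩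
    · simp only [Finset.mem_biUnion, mem_children hG, hS]
      constructor
      · rintro ⟨y, hy, hx, rfl⟩
        rw [dist_parent hG hx, hy]
      · intro h
        have hx : x ≠ r := by rintro rfl; simp at h
        exact ⟨_, by have := dist_parent hG hx; lia, hx, rfl⟩
    · rw [Finset.card_biUnion (fun x _ y _ h => children_disjoint hG r h),
        Finset.sum_congr rfl (g := fun _ => 2), Finset.sum_const, hc, smul_eq_mul]
      · ring
      · intro x hx
        rw [card_children hG hdeg, if_neg]
        rintro rfl
        rw [hS] at hx
        simp at hx

end Tree

/-! ### Infection times along the unique path -/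

section InfectionTime

variable {V : Type*} {G : SimpleGraph V}

theorem walkDelay_concat (x : G.edgeSet → ℝ) {u v w : V} (p : G.Walk u v) (h : G.Adj v w) :
    walkDelay x (p.concat h) = walkDelay x p + x ⟨s(v, w), h⟩ := by
  induction p with
  | nil => simp [SimpleGraph.Walk.concat_nil, walkDelay]
  | cons h' p ih => rw [SimpleGraph.Walk.concat_cons, walkDelay, walkDelay, ih, add_assoc]

theorem infectionTime_eq (hG : G.IsTree) (x : G.edgeSet → ℝ) {u v : V} (p : G.Walk u v)
    (hp : p.IsPath) : infectionTime x u v = walkDelay x p := by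
  have : Subsingleton (G.Path u v) := hG.isAcyclic.subsingleton_path u v
  have : Nonempty (G.Path u v) := ⟨⟨p, hp⟩⟩
  rw [infectionTime]
  refine (iInf_congr fun q => ?_).trans ciInf_const
  rw [Subsingleton.elim q ⟨p, hp⟩]

theorem infectionTime_root (hG : G.IsTree) (x : G.edgeSet → ℝ) (r : V) :
    infectionTime x r r = 0 :=
  infectionTime_eq hG x .nil .nil

theorem infectionTime_step (hG : G.IsTree) (x : G.edgeSet → ℝ) {r v : V} (hv : v ≠ r) :
    infectionTime x r v = infectionTime x r (parent G r v) +
      x ⟨s(parent G r v, v), (parent_adj hG hv).symm⟩ := by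
  obtain ⟨p, hp, hl⟩ := hG.connected.exists_path_of_dist r (parent G r v)
  have hp' : (p.concat (parent_adj hG hv).symm).IsPath := by
    apply SimpleGraph.Walk.isPath_of_length_eq_dist
    rw [SimpleGraph.Walk.length_concat, hl, ← dist_parent hG hv]
  rw [infectionTime_eq hG x p hp, infectionTime_eq hG x _ hp', walkDelay_concat]

end InfectionTime

/-! ### Competing exponential clocks -/

section Exponential

instance : IsProbabilityMeasure (expMeasure 1) := isProbabilityMeasure_expMeasure one_pos

/-- The integrand is the probability that `k` fresh clocks outlast the remaining time `t - c` of a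
clock of age `c`. The factor 1/(k + 1) is the chance of being first among k + 1 clocks; `k = 0`
gives the exponential tail. -/
theorem lintegral_Ioi_expMeasure (k : ℕ) {c : ℝ} (hc : 0 ≤ c) :
    ∫⁻ t in Set.Ioi c, ENNReal.ofReal (Real.exp (-(k * (t - c)))) ∂(expMeasure 1) =
      ENNReal.ofReal (Real.exp (-c)) / (k + 1 : ℕ) := by
  have h0 : expMeasure 1 = volume.withDensity (exponentialPDF 1) := rfl
  have hm : Measurable (exponentialPDF 1) :=
    (measurable_exponentialPDFReal 1).ennreal_ofReal
  rw [h0, setLIntegral_withDensity_eq_setLIntegral_mul _ hm (by fun_prop) measurableSet_Ioi]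
  have h1 : ∀ t ∈ Set.Ioi c,
      (exponentialPDF 1 * fun t => ENNReal.ofReal (Real.exp (-(k * (t - c))))) t =
        ENNReal.ofReal (Real.exp (k * c) * Real.exp ((-(k + 1 : ℝ)) * t)) := by
    intro t ht
    rw [Pi.mul_apply, exponentialPDF_of_nonneg (hc.trans (le_of_lt ht)), one_mul, one_mul,
      ← ENNReal.ofReal_mul (Real.exp_nonneg _), ← Real.exp_add, ← Real.exp_add]
    congr 2
    ring
  have ha : (-(k + 1 : ℝ)) < 0 := by linarith [Nat.cast_nonneg (α := ℝ) k]
  rw [setLIntegral_congr_fun measurableSet_Ioi h1, ← ofReal_integral_eq_lintegral_ofReal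
    ((integrableOn_exp_mul_Ioi ha c).const_mul _)
    (ae_of_all _ fun t => by positivity), integral_const_mul, integral_exp_mul_Ioi ha,
    ← ENNReal.ofReal_natCast, ← ENNReal.ofReal_div_of_pos (by positivity)]
  congr 1
  rw [neg_div_neg_eq, mul_div_assoc', ← Real.exp_add]
  push_cast
  congr 2
  ring

theorem expMeasure_Ioi {c : ℝ} (hc : 0 ≤ c) :
    expMeasure 1 (Set.Ioi c) = ENNReal.ofReal (Real.exp (-c)) := by
  simpa using lintegral_Ioi_expMeasure 0 hc

theorem expMeasure_pos : ∀ᵐ x ∂(expMeasure 1), 0 < x := by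
  have h := expMeasure_Ioi le_rfl
  rw [neg_zero, Real.exp_zero, ENNReal.ofReal_one] at h
  exact (prob_compl_eq_zero_iff measurableSet_Ioi).mpr h

variable {ι : Type*} [Fintype ι]

theorem pi_expMeasure_Ioi {c : ι → ℝ} (hc : ∀ i, 0 ≤ c i) :
    Measure.pi (fun _ : ι => expMeasure 1) {x | ∀ i, c i < x i} =
      ∏ i, ENNReal.ofReal (Real.exp (-(c i))) := by
  have : {x : ι → ℝ | ∀ i, c i < x i} = Set.univ.pi fun i => Set.Ioi (c i) := by
    ext x; simp
  rw [this, Measure.pi_pi]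
  exact Finset.prod_congr rfl fun i _ => expMeasure_Ioi (hc i)

/-- Among independent exponential clocks with ages `c i` that have not rung yet, each is equally
likely to be the first to ring. -/
theorem pi_expMeasure_first {c : ι → ℝ} (hc : ∀ i, 0 ≤ c i) (j : ι) :
    Measure.pi (fun _ : ι => expMeasure 1)
        {x | (∀ i, c i < x i) ∧ ∀ i, i ≠ j → x j - c j < x i - c i} =
      Measure.pi (fun _ : ι => expMeasure 1) {x | ∀ i, c i < x i} / Fintype.card ι := by
  classical
  have : Nonempty ι := ⟨j⟩
  let e := MeasurableEquiv.piEquivPiSubtypeProd (fun _ : ι => ℝ) (fun i => i = j)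
  have he := measurePreserving_piEquivPiSubtypeProd (fun _ : ι => expMeasure 1) (fun i => i = j)
  let T : Set (({i // i = j} → ℝ) × ({i // ¬ i = j} → ℝ)) :=
    {p | c j < p.1 ⟨j, rfl⟩ ∧ ∀ i : {i // ¬ i = j}, c i < p.2 i ∧
      p.1 ⟨j, rfl⟩ - c j < p.2 i - c i}
  have hT : MeasurableSet T := by
    have h1 : MeasurableSet {p : ({i // i = j} → ℝ) × ({i // ¬ i = j} → ℝ) |
        c j < p.1 ⟨j, rfl⟩} := measurableSet_lt (by fun_prop) (by fun_prop)
    refine h1.inter ?_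
    have : MeasurableSet {p : ({i // i = j} → ℝ) × ({i // ¬ i = j} → ℝ) |
        ∀ i : {i // ¬ i = j}, c i < p.2 i ∧ p.1 ⟨j, rfl⟩ - c j < p.2 i - c i} := by
      simp only [Set.ofPred_forall, Set.ofPred_and]
      exact MeasurableSet.iInter fun i => (measurableSet_lt (by fun_prop) (by fun_prop)).inter
        (measurableSet_lt (by fun_prop) (by fun_prop))
    exact this
  have hpre : {x : ι → ℝ | (∀ i, c i < x i) ∧ ∀ i, i ≠ j → x j - c j < x i - c i} = e ⁻¹' T := by
    ext x
    simp only [Set.mem_ofPred_eq, Set.mem_preimage, T, e,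
      MeasurableEquiv.piEquivPiSubtypeProd, MeasurableEquiv.coe_mk,
      Equiv.piEquivPiSubtypeProd_apply]
    constructor
    · exact fun h => ⟨h.1 j, fun i => ⟨h.1 i, h.2 i i.2⟩⟩
    · intro h
      refine ⟨fun i => ?_, fun i hi => (h.2 ⟨i, hi⟩).2⟩
      by_cases hi : i = j
      · exact hi ▸ h.1
      · exact (h.2 ⟨i, hi⟩).1
  have hcard : Fintype.card {i // ¬ i = j} + 1 = Fintype.card ι := by
    rw [Fintype.card_subtype_compl, Fintype.card_subtype_eq]
    have := Fintype.card_pos (α := ι)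
    lia
  rw [hpre, he.measure_preimage hT.nullMeasurableSet, Measure.prod_apply hT,
    pi_expMeasure_Ioi hc]
  -- Fubini with clock `j` outside: if it rings at `t > c j`, every other clock must exceed `c i +
  -- (t - c j)`, which has a product of exponential tails as its probability.
  have hsec : ∀ y : {i // i = j} → ℝ, Measure.pi (fun _ : {i // ¬ i = j} => expMeasure 1)
      (Prod.mk y ⁻¹' T) = (Set.Ioi (c j)).indicator (fun t =>
        (∏ i : {i // ¬ i = j}, ENNReal.ofReal (Real.exp (-(c i)))) *
        ENNReal.ofReal (Real.exp (-((Fintype.card {i // ¬ i = j} : ℕ) * (t - c j)))))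
        (y ⟨j, rfl⟩) := by
    intro y
    by_cases hy : c j < y ⟨j, rfl⟩
    · rw [Set.indicator_of_mem (show y ⟨j, rfl⟩ ∈ Set.Ioi (c j) from hy)]
      have : Prod.mk y ⁻¹' T = {x | ∀ i : {i // ¬ i = j}, c i + (y ⟨j, rfl⟩ - c j) < x i} := by
        ext x
        simp only [Set.mem_preimage, Set.mem_ofPred_eq, T]
        constructor
        · intro h i; linarith [(h.2 i).2]
        · intro h
          refine ⟨hy, fun i => ⟨?_, ?_⟩⟩ <;> linarith [h i]
      rw [this, pi_expMeasure_Ioi (fun i => by linarith [hc i])]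
      simp_rw [neg_add, Real.exp_add, ENNReal.ofReal_mul (Real.exp_nonneg _)]
      rw [Finset.prod_mul_distrib, Finset.prod_const, ← ENNReal.ofReal_pow (Real.exp_nonneg _),
        ← Real.exp_nat_mul, Finset.card_univ]
      congr 3
      ring
    · rw [Set.indicator_of_notMem (show y ⟨j, rfl⟩ ∉ Set.Ioi (c j) from hy)]
      convert measure_empty (μ := Measure.pi (fun _ : {i // ¬ i = j} => expMeasure 1))
      ext x
      simp only [Set.mem_preimage, Set.mem_ofPred_eq, T, Set.mem_empty_iff_false, iff_false]
      exact fun h => hy h.1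
  simp_rw [hsec]
  have hu := measurePreserving_piUnique (fun _ : {i // i = j} => expMeasure 1)
  have := hu.lintegral_comp (f := (Set.Ioi (c j)).indicator (fun t =>
        (∏ i : {i // ¬ i = j}, ENNReal.ofReal (Real.exp (-(c i)))) *
        ENNReal.ofReal (Real.exp (-((Fintype.card {i // ¬ i = j} : ℕ) * (t - c j))))))
    (Measurable.indicator (by fun_prop) measurableSet_Ioi)
  convert this.trans ?_
  · rfl
  rw [lintegral_indicator measurableSet_Ioi, lintegral_const_mul _ (by fun_prop),
    lintegral_Ioi_expMeasure _ (hc j), hcard, ← mul_div_assoc]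
  congr 1
  rw [mul_comm, ← Fintype.prod_subtype_mul_prod_subtype (fun i => i = j)
    (fun i => ENNReal.ofReal (Real.exp (-(c i))))]
  congr 1
  refine (Finset.prod_eq_single (f := fun i : {i // i = j} =>
    ENNReal.ofReal (Real.exp (-(c i)))) ⟨j, rfl⟩
    (fun i _ hi => absurd (Subtype.ext i.2) hi) (fun h => absurd ?_ h)).symm
  exact @Finset.mem_univ _ (Subtype.fintype fun i => i = j) _

end Exponential

/-! ### Memorylessness with random ages -/

section Race

variable {κ Ω : Type*} [MeasurableSpace Ω] {P : Measure Ω} [IsProbabilityMeasure P]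
  {Y : κ → Ω → ℝ}

/-- The memoryless property: given the variables indexed by `A` and that the clocks indexed by `B`
have not rung at ages `c`, each of these clocks is equally likely to be the first to ring. -/
theorem measure_first_clock (hY : ∀ e, Measurable (Y e)) (hind : iIndepFun Y P)
    (hlaw : ∀ e, P.map (Y e) = expMeasure 1) {A B : Finset κ} (hAB : Disjoint A B)
    {S : Set (A → ℝ)} (hS : MeasurableSet S) {c : B → (A → ℝ) → ℝ}
    (hc : ∀ b, Measurable (c b)) (hc0 : ∀ z ∈ S, ∀ b, 0 ≤ c b z) (j : B) :
    P {ω | (fun a : A => Y a ω) ∈ S ∧ (∀ b : B, c b (fun a : A => Y a ω) < Y b ω) ∧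
        ∀ b : B, b ≠ j → Y j ω - c j (fun a : A => Y a ω) < Y b ω - c b (fun a : A => Y a ω)} =
      P {ω | (fun a : A => Y a ω) ∈ S ∧ ∀ b : B, c b (fun a : A => Y a ω) < Y b ω} /
        (B.card : ENNReal) := by
  let Z : Ω → (A → ℝ) := fun ω a => Y a ω
  let X : Ω → (B → ℝ) := fun ω b => Y b ω
  have hZ : Measurable Z := measurable_pi_lambda _ fun a => hY a
  have hX : Measurable X := measurable_pi_lambda _ fun b => hY b
  have hZX : IndepFun Z X P := hind.indepFun_finset A B hAB hY
  have hXlaw : P.map X = Measure.pi fun _ : B => expMeasure 1 := by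
    have := (hind.precomp (g := ((↑) : B → κ)) Subtype.val_injective).map_fun_eq_pi_map
      (f := fun b : B => Y b) (fun b => (hY b).aemeasurable)
    simp only [hlaw] at this
    exact this
  -- By independence the joint law is a product, so the ages can be frozen and `pi_expMeasure_first`
  -- applied in each fiber.
  have hlawZX : P.map (fun ω => (Z ω, X ω)) =
      (P.map Z).prod (Measure.pi fun _ : B => expMeasure 1) := by
    rw [← hXlaw]
    exact (indepFun_iff_map_prod_eq_prod_map_map hZ.aemeasurable hX.aemeasurable).mp hZX
  have : IsProbabilityMeasure (P.map Z) := Measure.isProbabilityMeasure_map hZ.aemeasurable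
  let U : Set ((A → ℝ) × (B → ℝ)) := {p | p.1 ∈ S ∧ ∀ b : B, c b p.1 < p.2 b}
  let U' : Set ((A → ℝ) × (B → ℝ)) := {p | p.1 ∈ S ∧ (∀ b : B, c b p.1 < p.2 b) ∧
    ∀ b : B, b ≠ j → p.2 j - c j p.1 < p.2 b - c b p.1}
  have hcm : ∀ b, Measurable fun p : (A → ℝ) × (B → ℝ) => c b p.1 :=
    fun b => (hc b).comp measurable_fst
  have hxm : ∀ b, Measurable fun p : (A → ℝ) × (B → ℝ) => p.2 b :=
    fun b => (measurable_pi_apply b).comp measurable_snd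
  have hall : MeasurableSet {p : (A → ℝ) × (B → ℝ) | ∀ b : B, c b p.1 < p.2 b} := by
    simp only [Set.ofPred_forall]
    exact MeasurableSet.iInter fun b => measurableSet_lt (hcm b) (hxm b)
  have hU : MeasurableSet U := (measurable_fst hS).inter hall
  have hU' : MeasurableSet U' := by
    refine (measurable_fst hS).inter (hall.inter ?_)
    have : MeasurableSet {p : (A → ℝ) × (B → ℝ) |
        ∀ b : B, b ≠ j → p.2 j - c j p.1 < p.2 b - c b p.1} := by
      simp only [Set.ofPred_forall]
      exact MeasurableSet.iInter fun b => MeasurableSet.iInter fun _ =>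
        measurableSet_lt ((hxm j).sub (hcm j)) ((hxm b).sub (hcm b))
    exact this
  have hpair : Measurable fun ω => (Z ω, X ω) := hZ.prodMk hX
  change P ((fun ω => (Z ω, X ω)) ⁻¹' U') = P ((fun ω => (Z ω, X ω)) ⁻¹' U) / _
  rw [← Measure.map_apply hpair hU, ← Measure.map_apply hpair hU', hlawZX,
    Measure.prod_apply hU, Measure.prod_apply hU']
  simp_rw [div_eq_mul_inv]
  rw [← lintegral_mul_const _ (measurable_measure_prodMk_left hU)]
  refine lintegral_congr fun z => ?_
  by_cases hz : z ∈ S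
  · have h1 : Prod.mk z ⁻¹' U = {x | ∀ b, c b z < x b} := by
      ext x; simp [U, hz]
    have h2 : Prod.mk z ⁻¹' U' = {x | (∀ b, c b z < x b) ∧
        ∀ b, b ≠ j → x j - c j z < x b - c b z} := by
      ext x; simp [U', hz]
    rw [h1, h2, pi_expMeasure_first (hc0 z hz), div_eq_mul_inv, Fintype.card_coe]
  · have h1 : Prod.mk z ⁻¹' U = ∅ := by
      ext x; simp [U, hz]
    have h2 : Prod.mk z ⁻¹' U' = ∅ := by
      ext x; simp [U', hz]
    simp [h1, h2]

end Race

/-! ### Boundary size of a finite subtree -/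

section Boundary

variable {V : Type*} {G : SimpleGraph V} [G.LocallyFinite] [DecidableEq V]

/-- The nodes outside `A` that have a neighbor in `A`. -/
noncomputable def outer (G : SimpleGraph V) [G.LocallyFinite] (A : Finset V) : Finset V :=
  A.biUnion (fun a => G.neighborFinset a) \ A

theorem mem_outer {A : Finset V} {b : V} : b ∈ outer G A ↔ b ∉ A ∧ ∃ a ∈ A, G.Adj b a := by
  simp only [outer, Finset.mem_sdiff, Finset.mem_biUnion, SimpleGraph.mem_neighborFinset]
  rw [and_comm]
  simp only [G.adj_comm]

/-- `A` is the node set of a subtree that contains the root `r`. -/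
structure IsRooted (G : SimpleGraph V) (r : V) (A : Finset V) : Prop where
  root_mem : r ∈ A
  parent_mem : ∀ a ∈ A, parent G r a ∈ A

variable {r : V} {A : Finset V}

omit [G.LocallyFinite] [DecidableEq V] in
theorem isRooted_singleton (G : SimpleGraph V) (r : V) : IsRooted G r {r} :=
  ⟨Finset.mem_singleton_self r, fun a ha => by
    rw [Finset.mem_singleton.mp ha, parent_root]; exact Finset.mem_singleton_self r⟩

theorem IsRooted.mem_outer (hG : G.IsTree) (hA : IsRooted G r A) {b : V} :
    b ∈ outer G A ↔ b ∉ A ∧ parent G r b ∈ A := by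
  rw [Rumor.mem_outer]
  refine and_congr_right fun hb => ⟨?_, fun h => ⟨_, h, parent_adj hG ?_⟩⟩
  · rintro ⟨a, ha, hab⟩
    rcases (adj_iff_parent hG (r := r)).mp hab with ⟨-, rfl⟩ | ⟨-, rfl⟩
    · exact ha
    · exact absurd (hA.parent_mem a ha) hb
  · rintro rfl; exact hb hA.root_mem

theorem IsRooted.ne_root_of_mem_outer (hA : IsRooted G r A) {b : V}
    (hb : b ∈ outer G A) : b ≠ r := by
  rintro rfl; exact (Rumor.mem_outer.mp hb).1 hA.root_mem

theorem IsRooted.insert_outer (hG : G.IsTree) (hA : IsRooted G r A) {b : V} (hb : b ∈ outer G A) :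
    IsRooted G r (insert b A) := by
  refine ⟨Finset.mem_insert_of_mem hA.root_mem, fun a ha => Finset.mem_insert_of_mem ?_⟩
  rcases Finset.mem_insert.mp ha with rfl | ha
  · exact ((hA.mem_outer hG).mp hb).2
  · exact hA.parent_mem a ha

open Classical in
-- Apart from `v`, the infected or exposed nodes of the branch are exactly the children of its
-- infected nodes. Each of these has two children, the root three, so |S| + |O| = 1 + 2|S|, with one
-- more if the root belongs to S.
theorem IsRooted.card_outer_branch_aux (hG : G.IsTree) (hdeg : G.IsRegularOfDegree 3)
    (hA : IsRooted G r A) {v : V} (hv : parent G r v ∈ A) :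
    ((outer G A).filter (· ∈ branch G r v)).card =
      (A.filter (· ∈ branch G r v)).card + if v = r then 2 else 1 := by
  set S := A.filter (· ∈ branch G r v) with hS
  set O := (outer G A).filter (· ∈ branch G r v) with hO
  have hun : insert v (S.biUnion (children G r)) = S ∪ O := by
    ext x
    simp only [Finset.mem_insert, Finset.mem_biUnion, mem_children hG, Finset.mem_union, hS, hO,
      Finset.mem_filter, hA.mem_outer hG]
    constructor
    · rintro (rfl | ⟨a, ⟨ha, hab⟩, hx, rfl⟩)
      · by_cases hxA : x ∈ A
        · exact .inl ⟨hxA, self_mem_branch _ _⟩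
        · exact .inr ⟨⟨hxA, hv⟩, self_mem_branch _ _⟩
      · by_cases hxA : x ∈ A
        · exact .inl ⟨hxA, mem_branch_of_parent hG hab⟩
        · exact .inr ⟨⟨hxA, ha⟩, mem_branch_of_parent hG hab⟩
    · intro h
      by_cases hxv : x = v
      · exact .inl hxv
      refine .inr ⟨parent G r x, ?_⟩
      have hb : x ∈ branch G r v := by rcases h with h | h; exacts [h.2, h.2]
      have hp : parent G r x ∈ A := by
        rcases h with h | h
        exacts [hA.parent_mem x h.1, h.1.2]
      exact ⟨⟨hp, parent_mem_branch hG hb hxv⟩,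
        (((mem_branch_iff hG).mp hb).resolve_left hxv).1, rfl⟩
  have hnot : v ∉ S.biUnion (children G r) := by
    simp only [Finset.mem_biUnion, mem_children hG, not_exists, not_and, hS, Finset.mem_filter]
    rintro a ⟨-, ha⟩ hvr rfl
    exact not_mem_branch_parent hG hvr ha
  have hdis : Disjoint S O := by
    rw [Finset.disjoint_left]
    intro x hx hx'
    exact (Rumor.mem_outer.mp (Finset.mem_filter.mp hx').1).1 (Finset.mem_filter.mp hx).1
  have hcard := congrArg Finset.card hun
  rw [Finset.card_insert_of_notMem hnot, Finset.card_union_of_disjoint hdis,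
    Finset.card_biUnion (fun x _ y _ h => children_disjoint hG r h),
    Finset.sum_congr rfl (fun x _ => card_children hG hdeg r x)] at hcard
  split_ifs with hvr
  · have hr : r ∈ S := by
      rw [hS, Finset.mem_filter, hvr]; exact ⟨hA.root_mem, self_mem_branch _ _⟩
    rw [← Finset.add_sum_erase _ _ hr, if_pos rfl,
      Finset.sum_congr rfl (fun x hx => if_neg (Finset.ne_of_mem_erase hx)), Finset.sum_const,
      Finset.card_erase_of_mem hr, smul_eq_mul] at hcard
    have := Finset.card_pos.mpr ⟨r, hr⟩
    lia
  · have hr : ∀ x ∈ S, x ≠ r := by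
      rintro x hx rfl
      exact hvr ((root_mem_branch_iff hG).mp (Finset.mem_filter.mp hx).2)
    rw [Finset.sum_congr rfl (fun x hx => if_neg (hr x hx)), Finset.sum_const,
      smul_eq_mul] at hcard
    lia

open Classical in
theorem IsRooted.card_outer_branch (hG : G.IsTree) (hdeg : G.IsRegularOfDegree 3)
    (hA : IsRooted G r A) {v : V} (hvr : v ≠ r) (hv : parent G r v ∈ A) :
    ((outer G A).filter (· ∈ branch G r v)).card =
      (A.filter (· ∈ branch G r v)).card + 1 := by
  rw [hA.card_outer_branch_aux hG hdeg hv, if_neg hvr]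

theorem IsRooted.card_outer (hG : G.IsTree) (hdeg : G.IsRegularOfDegree 3)
    (hA : IsRooted G r A) : (outer G A).card = A.card + 2 := by
  classical
  have h := hA.card_outer_branch_aux hG hdeg (v := r) (by rw [parent_root]; exact hA.root_mem)
  have hall : ∀ x, x ∈ branch G r r := fun x => by simp [branch]
  rwa [Finset.filter_true_of_mem (fun x _ => hall x), Finset.filter_true_of_mem (fun x _ => hall x),
    if_pos rfl] at h

end Boundary

/-! ### Infection times as sums over nodes -/

section PathSum

variable {V : Type*} {G : SimpleGraph V}

/-- The sum of `f` over the nodes, except the root `r`, between `r` and `v`. -/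
noncomputable def pathSum (G : SimpleGraph V) (r : V) (f : V → ℝ) (v : V) : ℝ :=
  ∑ k ∈ Finset.range (G.dist r v), f ((parent G r)^[k] v)

theorem pathSum_root (r : V) (f : V → ℝ) : pathSum G r f r = 0 := by simp [pathSum]

theorem pathSum_step (hG : G.IsTree) {r v : V} (f : V → ℝ) (hv : v ≠ r) :
    pathSum G r f v = pathSum G r f (parent G r v) + f v := by
  rw [pathSum, dist_parent hG hv, Finset.sum_range_succ', pathSum]
  rfl

/-- A subtree contains the paths from the root to its nodes. Thus infection times in `A` depend only
on delays inside `A`, which is what independence from the boundary clocks requires. -/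
theorem pathSum_congr (hG : G.IsTree) {r : V} {A : Finset V} (hA : IsRooted G r A) {f g : V → ℝ}
    (hfg : ∀ a ∈ A, a ≠ r → f a = g a) {a : V} (ha : a ∈ A) :
    pathSum G r f a = pathSum G r g a := by
  induction a using parent_induction hG r with
  | root => rw [pathSum_root, pathSum_root]
  | step x hx ih =>
    rw [pathSum_step hG f hx, pathSum_step hG g hx, ih (hA.parent_mem x ha), hfg x ha hx]

theorem infectionTime_eq_pathSum (hG : G.IsTree) (x : G.edgeSet → ℝ) (r : V) (f : V → ℝ)
    (hf : ∀ v (hv : v ≠ r), f v = x ⟨s(parent G r v, v), (parent_adj hG hv).symm⟩) (v : V) :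
    infectionTime x r v = pathSum G r f v := by
  induction v using parent_induction hG r with
  | root => rw [infectionTime_root hG, pathSum_root]
  | step v hv ih => rw [infectionTime_step hG x hv, pathSum_step hG f hv, ih, hf v hv]

end PathSum

/-! ### The next infected node is uniform on the boundary -/

section Growth

variable {V : Type*} {G : SimpleGraph V} [G.LocallyFinite] [DecidableEq V]
  {Ω : Type*}

/-- The event that all nodes of `A` are infected before the nodes next to `A`. -/
def growthEvent (τ : G.edgeSet → Ω → ℝ) (r : V) (A : Finset V) : Set Ω :=
  {ω | ∀ a ∈ A, ∀ b ∈ outer G A,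
    infectionTime (fun e => τ e ω) r a < infectionTime (fun e => τ e ω) r b}

/-- The path from the root to `v` leaves `A` at a boundary node, and infection times increase along
it. -/
theorem exists_mem_outer_le (hG : G.IsTree) {r : V} {A : Finset V} (hA : IsRooted G r A)
    {x : G.edgeSet → ℝ} (hx : ∀ e, 0 < x e) {v : V} (hv : v ∉ A) :
    ∃ b ∈ outer G A, infectionTime x r b ≤ infectionTime x r v := by
  induction v using parent_induction hG r with
  | root => exact absurd hA.root_mem hv
  | step v hvr ih =>
    by_cases hp : parent G r v ∈ A
    · exact ⟨v, (hA.mem_outer hG).mpr ⟨hv, hp⟩, le_rfl⟩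
    · obtain ⟨b, hb, hle⟩ := ih hp
      refine ⟨b, hb, hle.trans ?_⟩
      rw [infectionTime_step hG x hvr]
      linarith [hx ⟨s(parent G r v, v), (parent_adj hG hvr).symm⟩]

/-- Replaces ranks among infinitely many infection times by finitely many comparisons. A boundary
node not later than some node of `A` would have a rank below |A|. Conversely, if `A` precedes its
boundary, it precedes everything outside, so ranks are below |A| exactly on `A`. -/
theorem mem_observedEvent_iff (hG : G.IsTree) {r : V} {A : Finset V} (hA : IsRooted G r A)
    {τ : G.edgeSet → Ω → ℝ} {ω : Ω} (hω : ∀ e, 0 < τ e ω) :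
    ω ∈ observedEvent τ r A.card A ↔ ω ∈ growthEvent τ r A := by
  set x : G.edgeSet → ℝ := fun e => τ e ω with hx
  change infectedNodes x r A.card = A ↔ ∀ a ∈ A, ∀ b ∈ outer G A, _
  constructor
  · intro h a ha b hb
    have h1 : ({u | infectionTime x r u < infectionTime x r a} : Set V).encard < A.card := by
      have : a ∈ infectedNodes x r A.card := h ▸ (Finset.mem_coe.mpr ha)
      exact this
    have h2 : ¬ ({u | infectionTime x r u < infectionTime x r b} : Set V).encard < A.card := by
      intro hlt
      have : b ∈ infectedNodes x r A.card := hlt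
      rw [h] at this
      exact (mem_outer.mp hb).1 this
    by_contra hle
    refine h2 (lt_of_le_of_lt (Set.encard_le_encard fun u hu => ?_) h1)
    exact lt_of_lt_of_le hu (not_lt.mp hle)
  · intro h
    ext v
    change ({u | infectionTime x r u < infectionTime x r v} : Set V).encard < A.card ↔ v ∈ A
    constructor
    · intro hlt
      by_contra hv
      obtain ⟨b, hb, hle⟩ := exists_mem_outer_le hG hA hω hv
      refine absurd hlt (not_lt.mpr ?_)
      rw [← Set.encard_coe_eq_coe_finsetCard]
      exact Set.encard_le_encard fun a ha => (h a ha b hb).trans_le hle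
    · intro hv
      have hsub : {u | infectionTime x r u < infectionTime x r v} ⊆ ((A.erase v : Finset V) : Set V) := by
        intro u hu
        rw [Finset.mem_coe, Finset.mem_erase]
        refine ⟨by rintro rfl; exact lt_irrefl (infectionTime x r u) (Set.mem_ofPred.mp hu), ?_⟩
        by_contra huA
        obtain ⟨b, hb, hle⟩ := exists_mem_outer_le hG hA hω huA
        exact absurd ((h v hv b hb).trans_le hle) (not_lt.mpr (le_of_lt hu))
      refine (Set.encard_le_encard hsub).trans_lt ?_
      rw [Set.encard_coe_eq_coe_finsetCard, Nat.cast_lt]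
      exact Finset.card_erase_lt_of_mem hv

omit [G.LocallyFinite] [DecidableEq V] in
theorem observedEvent_disjoint (τ : G.edgeSet → Ω → ℝ) (r : V) (n : ℕ) {A B : Finset V}
    (h : A ≠ B) : Disjoint (observedEvent τ r n A) (observedEvent τ r n B) := by
  rw [Set.disjoint_left]
  intro ω hA hB
  exact h (Finset.coe_injective ((Eq.symm hA).trans hB))

/-- The boundary of `insert j A` consists of the other old boundary nodes and the children of `j`;
the latter are later than `j` anyway. -/
theorem mem_growthEvent_insert_iff (hG : G.IsTree) {r : V} {A : Finset V} (hA : IsRooted G r A)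
    {τ : G.edgeSet → Ω → ℝ} {ω : Ω} (hω : ∀ e, 0 < τ e ω) (hgA : ω ∈ growthEvent τ r A)
    {j : V} (hj : j ∈ outer G A) :
    ω ∈ growthEvent τ r (insert j A) ↔ ∀ b ∈ outer G A, b ≠ j →
      infectionTime (fun e => τ e ω) r j < infectionTime (fun e => τ e ω) r b := by
  have hA' := hA.insert_outer hG hj
  constructor
  · intro h b hb hbj
    refine h j (Finset.mem_insert_self _ _) b ((hA'.mem_outer hG).mpr ⟨?_, ?_⟩)
    · rw [Finset.mem_insert, not_or]; exact ⟨hbj, (mem_outer.mp hb).1⟩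
    · exact Finset.mem_insert_of_mem ((hA.mem_outer hG).mp hb).2
  · intro h a ha b hb
    have hbr := hA'.ne_root_of_mem_outer hb
    rw [hA'.mem_outer hG, Finset.mem_insert, Finset.mem_insert, not_or] at hb
    have key : infectionTime (fun e => τ e ω) r j < infectionTime (fun e => τ e ω) r b := by
      rcases hb.2 with hp | hp
      · have h1 := infectionTime_step hG (fun e => τ e ω) hbr
        have h2 := congrArg (infectionTime (fun e => τ e ω) r) hp
        linarith [hω ⟨s(parent G r b, b), (parent_adj hG hbr).symm⟩]
      · exact h b ((hA.mem_outer hG).mpr ⟨hb.1.2, hp⟩) hb.1.1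
    rcases Finset.mem_insert.mp ha with rfl | ha
    · exact key
    · exact (hgA a ha j hj).trans key

variable [Countable V] [MeasurableSpace Ω] {P : Measure Ω} [IsProbabilityMeasure P]
  {τ : G.edgeSet → Ω → ℝ}

omit [G.LocallyFinite] [DecidableEq V] [Countable V] in
theorem measurable_infectionTime (hG : G.IsTree) (hτ : ∀ e, Measurable (τ e)) (r v : V) :
    Measurable fun ω => infectionTime (fun e => τ e ω) r v := by
  induction v using parent_induction hG r with
  | root => simp only [infectionTime_root hG]; exact measurable_const
  | step v hv ih => simp only [infectionTime_step hG _ hv]; exact ih.add (hτ _)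

omit [Countable V] in
theorem measurableSet_growthEvent (hG : G.IsTree) (hτ : ∀ e, Measurable (τ e)) (r : V)
    (A : Finset V) : MeasurableSet (growthEvent τ r A) := by
  simp only [growthEvent, Set.ofPred_forall]
  refine Finset.measurableSet_biInter _ fun a _ => Finset.measurableSet_biInter _ fun b _ => ?_
  exact measurableSet_lt (measurable_infectionTime hG hτ r a) (measurable_infectionTime hG hτ r b)

omit [G.LocallyFinite] [DecidableEq V] [IsProbabilityMeasure P] in
theorem ae_pos (hτ : ∀ e, Measurable (τ e)) (hlaw : ∀ e, P.map (τ e) = expMeasure 1) :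
    ∀ᵐ ω ∂P, ∀ e, 0 < τ e ω := by
  have : Countable G.edgeSet := by
    have : Countable (Sym2 V) := Quot.mk_surjective.countable
    infer_instance
  rw [ae_all_iff]
  intro e
  exact ae_of_ae_map (hτ e).aemeasurable (hlaw e ▸ expMeasure_pos)

omit [Countable V] in
-- The delays of the edges leaving `A` are clocks, started when their inner ends are infected. When
-- the last node of `A` is infected, the growth event says that none of them has rung, and
-- `measure_first_clock` applies.
theorem measure_growthEvent_inter_first (hG : G.IsTree) (hτ : ∀ e, Measurable (τ e))
    (hind : iIndepFun τ P) (hlaw : ∀ e, P.map (τ e) = expMeasure 1) {r : V} {A : Finset V}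
    (hA : IsRooted G r A) {j : V} (hj : j ∈ outer G A) :
    P (growthEvent τ r A ∩ {ω | ∀ b ∈ outer G A, b ≠ j →
      infectionTime (fun e => τ e ω) r j < infectionTime (fun e => τ e ω) r b}) =
      P (growthEvent τ r A) / ((outer G A).card : ENNReal) := by
  -- Each edge is indexed by its end farther from the root.
  let edge : {v // v ≠ r} → G.edgeSet := fun v =>
    ⟨s(parent G r v, v), (parent_adj hG v.2).symm⟩
  have hedge : edge.Injective := by
    rintro ⟨v, hv⟩ ⟨w, hw⟩ h
    have h := congrArg Subtype.val h
    simp only [edge, Sym2.eq_iff] at h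
    rcases h with h | h
    · exact Subtype.ext h.2
    · have h1 := dist_parent hG hv
      have h2 := dist_parent hG hw
      rw [h.1] at h1; rw [← h.2] at h2
      lia
  let Y : {v // v ≠ r} → Ω → ℝ := fun v => τ (edge v)
  let A' : Finset {v // v ≠ r} := A.subtype (· ≠ r)
  let B' : Finset {v // v ≠ r} := (outer G A).subtype (· ≠ r)
  have hAB : Disjoint A' B' := by
    rw [Finset.disjoint_left]
    intro v hv hv'
    exact (mem_outer.mp (Finset.mem_subtype.mp hv')).1 (Finset.mem_subtype.mp hv)
  -- The padding by 0 is harmless: paths to nodes of `A` stay in `A`, and `pathSum` omits the root.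
  let ext : (A' → ℝ) → V → ℝ := fun z v =>
    if h : v ∈ A ∧ v ≠ r then z ⟨⟨v, h.2⟩, Finset.mem_subtype.mpr h.1⟩ else 0
  have hext : ∀ v, Measurable fun z => ext z v := by
    intro v
    simp only [ext]
    split_ifs
    · exact measurable_pi_apply _
    · exact measurable_const
  let t : V → (A' → ℝ) → ℝ := fun v z => pathSum G r (ext z) v
  have ht : ∀ v, Measurable (t v) := fun v =>
    Finset.measurable_fun_sum _ fun k _ => hext _
  have hne : A.Nonempty := ⟨r, hA.root_mem⟩
  -- The infection time of the last node of `A`; below, `c b` is the age of the clock of `b` at this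
  -- time.
  let m : (A' → ℝ) → ℝ := A.sup' hne t
  have hm : Measurable m := Finset.measurable_sup' hne fun v _ => ht v
  have hmz : ∀ z, m z = A.sup' hne fun v => t v z := fun z => Finset.sup'_apply hne t z
  let c : B' → (A' → ℝ) → ℝ := fun b z => m z - t (parent G r b) z
  have hpar : ∀ b : B', parent G r b ∈ A := fun b =>
    ((hA.mem_outer hG).mp (Finset.mem_subtype.mp b.2)).2
  have hT : ∀ ω, ∀ a ∈ A, infectionTime (fun e => τ e ω) r a = t a (fun a : A' => Y a ω) := by
    intro ω a ha
    rw [infectionTime_eq_pathSum hG _ r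
      (fun v => if hv : v ≠ r then τ (edge ⟨v, hv⟩) ω else 0) (fun v hv => by simp [hv, edge])]
    refine pathSum_congr hG hA (fun a ha har => ?_) ha
    simp [ext, ha, har, Y]
  have hTb : ∀ ω, ∀ b : B', infectionTime (fun e => τ e ω) r b =
      t (parent G r b) (fun a : A' => Y a ω) + Y b ω := by
    intro ω b
    rw [infectionTime_step hG _ b.1.2, hT ω _ (hpar b)]
  have key := measure_first_clock (fun v => hτ (edge v)) (hind.precomp hedge)
    (fun v => hlaw (edge v)) hAB MeasurableSet.univ (c := c) (fun b => hm.sub (ht _))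
    (fun z _ b => by
      simp only [c, sub_nonneg, hmz]
      exact Finset.le_sup' (fun v => t v z) (hpar b))
    ⟨⟨j, hA.ne_root_of_mem_outer hj⟩, Finset.mem_subtype.mpr hj⟩
  have hB' : B'.card = (outer G A).card := by
    rw [Finset.card_subtype, Finset.filter_true_of_mem fun b hb => hA.ne_root_of_mem_outer hb]
  have hall : ∀ p : V → Prop, (∀ b ∈ outer G A, p b) ↔ ∀ b : B', p b := fun p =>
    ⟨fun h b => h b (Finset.mem_subtype.mp b.2),
      fun h b hb => h ⟨⟨b, hA.ne_root_of_mem_outer hb⟩, Finset.mem_subtype.mpr hb⟩⟩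
  have hgrow : ∀ ω, ω ∈ growthEvent τ r A ↔
      ∀ b : B', c b (fun a : A' => Y a ω) < Y b ω := by
    intro ω
    have : ω ∈ growthEvent τ r A ↔ ∀ b ∈ outer G A, ∀ a ∈ A,
        infectionTime (fun e => τ e ω) r a < infectionTime (fun e => τ e ω) r b :=
      ⟨fun h b hb a ha => h a ha b hb, fun h a ha b hb => h b hb a ha⟩
    rw [this, hall]
    refine forall_congr' fun b => ?_
    rw [hTb]
    simp only [c, hmz, sub_lt_iff_lt_add', Finset.sup'_lt_iff]
    exact forall₂_congr fun a ha => by rw [hT ω a ha]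
  rw [hB'] at key
  refine (congrArg P (Set.ext fun ω => ?_)).trans
    (key.trans (congrArg (fun s => P s / _) (Set.ext fun ω => ?_)))
  · rw [Set.mem_inter_iff, hgrow]
    simp only [Set.mem_ofPred_eq, Set.mem_univ, true_and, hall]
    refine and_congr_right fun _ => forall_congr' fun b => ?_
    rw [hTb, hTb ω ⟨⟨j, hA.ne_root_of_mem_outer hj⟩, Finset.mem_subtype.mpr hj⟩]
    simp only [c, ne_eq, Subtype.ext_iff]
    refine imp_congr_right fun _ => ?_
    constructor <;> intro h <;> simp only [Y] at h ⊢ <;> linarith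
  · rw [hgrow]
    simp only [Set.mem_ofPred_eq, Set.mem_univ, true_and, Y]

end Growth

/-! ### One-step transitions of the infected network -/

section Transition

variable {V : Type*} {G : SimpleGraph V} [G.LocallyFinite] [DecidableEq V] [Countable V]
  {Ω : Type*} [MeasurableSpace Ω] {P : Measure Ω} [IsProbabilityMeasure P]
  {τ : G.edgeSet → Ω → ℝ} {r : V} {A : Finset V}

omit [IsProbabilityMeasure P] in
theorem observedEvent_ae_eq (hG : G.IsTree) (hτ : ∀ e, Measurable (τ e))
    (hlaw : ∀ e, P.map (τ e) = expMeasure 1) (hA : IsRooted G r A) :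
    observedEvent τ r A.card A =ᵐ[P] growthEvent τ r A := by
  filter_upwards [ae_pos hτ hlaw] with ω hω
  exact propext (mem_observedEvent_iff hG hA hω)

omit [IsProbabilityMeasure P] in
theorem nullMeasurableSet_observedEvent_of_rooted (hG : G.IsTree) (hτ : ∀ e, Measurable (τ e))
    (hlaw : ∀ e, P.map (τ e) = expMeasure 1) (hA : IsRooted G r A) :
    NullMeasurableSet (observedEvent τ r A.card A) P :=
  (measurableSet_growthEvent hG hτ r A).nullMeasurableSet.congr
    (observedEvent_ae_eq hG hτ hlaw hA).symm

/-- The next infected node is uniformly distributed among the neighbors of the infected network. -/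
theorem measure_observedEvent_inter_insert (hG : G.IsTree) (hdeg : G.IsRegularOfDegree 3)
    (hτ : ∀ e, Measurable (τ e)) (hind : iIndepFun τ P)
    (hlaw : ∀ e, P.map (τ e) = expMeasure 1) (hA : IsRooted G r A) {j : V}
    (hj : j ∈ outer G A) :
    P (observedEvent τ r A.card A ∩ observedEvent τ r (A.card + 1) (insert j A)) =
      P (observedEvent τ r A.card A) / (A.card + 2 : ℕ) := by
  have hcard : (insert j A).card = A.card + 1 := Finset.card_insert_of_notMem (mem_outer.mp hj).1
  rw [measure_congr (observedEvent_ae_eq hG hτ hlaw hA), ← hA.card_outer hG hdeg,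
    ← measure_growthEvent_inter_first hG hτ hind hlaw hA hj, ← hcard]
  refine measure_congr ?_
  filter_upwards [ae_pos hτ hlaw] with ω hω
  refine propext ?_
  change (ω ∈ observedEvent τ r A.card A ∧ ω ∈ observedEvent τ r (insert j A).card (insert j A)) ↔
    (ω ∈ growthEvent τ r A ∧ _)
  rw [mem_observedEvent_iff hG hA hω, mem_observedEvent_iff hG (hA.insert_outer hG hj) hω]
  exact and_congr_right fun h => mem_growthEvent_insert_iff hG hA hω h hj

omit [IsProbabilityMeasure P] in
theorem nullMeasurableSet_inter_insert (hG : G.IsTree)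
    (hτ : ∀ e, Measurable (τ e)) (hlaw : ∀ e, P.map (τ e) = expMeasure 1) (hA : IsRooted G r A)
    {j : V} (hj : j ∈ outer G A) :
    NullMeasurableSet
      (observedEvent τ r A.card A ∩ observedEvent τ r (A.card + 1) (insert j A)) P := by
  have hcard : (insert j A).card = A.card + 1 := Finset.card_insert_of_notMem (mem_outer.mp hj).1
  rw [← hcard]
  exact (nullMeasurableSet_observedEvent_of_rooted hG hτ hlaw hA).inter
    (nullMeasurableSet_observedEvent_of_rooted hG hτ hlaw (hA.insert_outer hG hj))

omit [Countable V] in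
theorem insert_ne_insert {j k : V} (hj : j ∈ outer G A) (hjk : j ≠ k) :
    insert j A ≠ insert k A := by
  intro h
  have : j ∈ insert k A := h ▸ Finset.mem_insert_self j A
  rcases Finset.mem_insert.mp this with h | h
  · exact hjk h
  · exact (mem_outer.mp hj).1 h

/-- After the infected network `A`, the next network almost surely is `A` with one more node. -/
theorem ae_observedEvent_succ (hG : G.IsTree) (hdeg : G.IsRegularOfDegree 3)
    (hτ : ∀ e, Measurable (τ e)) (hind : iIndepFun τ P)
    (hlaw : ∀ e, P.map (τ e) = expMeasure 1) (hA : IsRooted G r A) :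
    ∀ᵐ ω ∂P, ω ∈ observedEvent τ r A.card A →
      ∃ j ∈ outer G A, ω ∈ observedEvent τ r (A.card + 1) (insert j A) := by
  set E := observedEvent τ r A.card A with hE
  set F : V → Set Ω := fun j => E ∩ observedEvent τ r (A.card + 1) (insert j A) with hF
  -- The |A| + 2 disjoint successor events each carry the fraction 1/(|A| + 2) of `P E`, so they
  -- exhaust `E` up to a null set.
  have hU : P (⋃ j ∈ outer G A, F j) = P E := by
    rw [measure_biUnion_finset₀]
    · rw [Finset.sum_congr rfl fun j hj =>
        measure_observedEvent_inter_insert hG hdeg hτ hind hlaw hA hj, Finset.sum_const,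
        hA.card_outer hG hdeg, nsmul_eq_mul]
      exact ENNReal.mul_div_cancel (by simp) (by simp)
    · intro j hj k _ hjk
      refine (Disjoint.mono Set.inter_subset_right Set.inter_subset_right
        (observedEvent_disjoint τ r _ (insert_ne_insert hj hjk))).aedisjoint
    · exact fun j hj => nullMeasurableSet_inter_insert hG hτ hlaw hA hj
  have hsub : (⋃ j ∈ outer G A, F j) ⊆ E := Set.iUnion₂_subset fun j _ => Set.inter_subset_left
  have hae : (⋃ j ∈ outer G A, F j) =ᵐ[P] E :=
    ae_eq_of_subset_of_measure_ge hsub hU.ge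
      (NullMeasurableSet.biUnion (Finset.countable_toSet _)
        fun j hj => nullMeasurableSet_inter_insert hG hτ hlaw hA hj) (measure_ne_top _ _)
  filter_upwards [hae] with ω hω hωE
  have : ω ∈ ⋃ j ∈ outer G A, F j := (Eq.symm hω).mp hωE
  simp only [Set.mem_iUnion, exists_prop] at this
  obtain ⟨j, hj, hjF⟩ := this
  exact ⟨j, hj, hjF.2⟩

theorem ae_exists_observedEvent (hG : G.IsTree) (hdeg : G.IsRegularOfDegree 3)
    (hτ : ∀ e, Measurable (τ e)) (hind : iIndepFun τ P)
    (hlaw : ∀ e, P.map (τ e) = expMeasure 1) (r : V) {n : ℕ} (hn : 1 ≤ n) :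
    ∀ᵐ ω ∂P, ∃ A, IsRooted G r A ∧ A.card = n ∧ ω ∈ observedEvent τ r n A := by
  induction n, hn using Nat.le_induction with
  | base =>
    filter_upwards [ae_pos hτ hlaw] with ω hω
    have hr := isRooted_singleton G r
    refine ⟨{r}, hr, rfl, (mem_observedEvent_iff hG hr hω).mpr ?_⟩
    intro a ha b hb
    have hbr := hr.ne_root_of_mem_outer hb
    have hp := Finset.mem_singleton.mp ((hr.mem_outer hG).mp hb).2
    have h1 := infectionTime_step hG (fun e => τ e ω) hbr
    have h2 := congrArg (infectionTime (fun e => τ e ω) r) hp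
    rw [Finset.mem_singleton.mp ha]
    linarith [hω ⟨s(parent G r b, b), (parent_adj hG hbr).symm⟩]
  | succ n hn ih =>
    -- There are only countably many finite sets, so one null set serves all `A`.
    have hall : ∀ᵐ ω ∂P, ∀ A : Finset V, IsRooted G r A → ω ∈ observedEvent τ r A.card A →
        ∃ j ∈ outer G A, ω ∈ observedEvent τ r (A.card + 1) (insert j A) := by
      rw [ae_all_iff]
      intro A
      by_cases hA : IsRooted G r A
      · filter_upwards [ae_observedEvent_succ hG hdeg hτ hind hlaw hA] with ω hω _ using hω
      · exact ae_of_all _ fun ω h => absurd h hA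
    filter_upwards [ih, hall] with ω ⟨A, hA, hc, hω⟩ h
    subst hc
    obtain ⟨j, hj, hjω⟩ := h A hA hω
    exact ⟨insert j A, hA.insert_outer hG hj,
      Finset.card_insert_of_notMem (mem_outer.mp hj).1, hjω⟩

theorem measure_observedEvent_eq_zero (hG : G.IsTree) (hdeg : G.IsRegularOfDegree 3)
    (hτ : ∀ e, Measurable (τ e)) (hind : iIndepFun τ P)
    (hlaw : ∀ e, P.map (τ e) = expMeasure 1) {n : ℕ} (hn : 1 ≤ n)
    (h : ¬ (IsRooted G r A ∧ A.card = n)) : P (observedEvent τ r n A) = 0 := by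
  rw [← compl_compl (observedEvent τ r n A)]
  change ∀ᵐ ω ∂P, ω ∈ (observedEvent τ r n A)ᶜ
  filter_upwards [ae_exists_observedEvent hG hdeg hτ hind hlaw r hn] with ω ⟨B, hB, hc, hω⟩ hωA
  refine Set.disjoint_left.mp (observedEvent_disjoint τ r n ?_) hω hωA
  rintro rfl
  exact h ⟨hB, hc⟩

theorem nullMeasurableSet_observedEvent (hG : G.IsTree) (hdeg : G.IsRegularOfDegree 3)
    (hτ : ∀ e, Measurable (τ e)) (hind : iIndepFun τ P)
    (hlaw : ∀ e, P.map (τ e) = expMeasure 1) {n : ℕ} (hn : 1 ≤ n) (r : V) (A : Finset V) :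
    NullMeasurableSet (observedEvent τ r n A) P := by
  by_cases h : IsRooted G r A ∧ A.card = n
  · obtain ⟨hA, rfl⟩ := h
    exact nullMeasurableSet_observedEvent_of_rooted hG hτ hlaw hA
  · exact NullMeasurableSet.of_null (measure_observedEvent_eq_zero hG hdeg hτ hind hlaw hn h)

/-- The probability of an event splits along the network of `n` infected nodes. -/
theorem measure_eq_tsum_observedEvent (hG : G.IsTree) (hdeg : G.IsRegularOfDegree 3)
    (hτ : ∀ e, Measurable (τ e)) (hind : iIndepFun τ P)
    (hlaw : ∀ e, P.map (τ e) = expMeasure 1) (r : V) {n : ℕ} (hn : 1 ≤ n) {E : Set Ω}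
    (hE : NullMeasurableSet E P) :
    P E = ∑' A : Finset V, P (observedEvent τ r n A ∩ E) := by
  rw [← measure_iUnion₀]
  · refine measure_congr ?_
    filter_upwards [ae_exists_observedEvent hG hdeg hτ hind hlaw r hn] with ω ⟨A, _, _, hA⟩
    refine propext ⟨fun h => Set.mem_iUnion.mpr ⟨A, hA, h⟩, fun h => ?_⟩
    obtain ⟨B, hB⟩ := Set.mem_iUnion.mp h
    exact hB.2
  · intro A B hAB
    exact (Disjoint.mono Set.inter_subset_left Set.inter_subset_left
      (observedEvent_disjoint τ r n hAB)).aedisjoint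
  · exact fun A => (nullMeasurableSet_observedEvent hG hdeg hτ hind hlaw hn r A).inter hE

theorem measure_observedEvent_succ (hG : G.IsTree) (hdeg : G.IsRegularOfDegree 3)
    (hτ : ∀ e, Measurable (τ e)) (hind : iIndepFun τ P)
    (hlaw : ∀ e, P.map (τ e) = expMeasure 1) (r : V) {n : ℕ} (hn : 1 ≤ n) (B : Finset V) :
    P (observedEvent τ r (n + 1) B) = ∑' A : Finset V, P (observedEvent τ r n A) / (n + 2 : ℕ) *
      ∑ j ∈ outer G A, if insert j A = B then 1 else 0 := by
  rw [measure_eq_tsum_observedEvent hG hdeg hτ hind hlaw r hn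
    (nullMeasurableSet_observedEvent hG hdeg hτ hind hlaw (by lia) r B)]
  refine tsum_congr fun A => ?_
  by_cases h : IsRooted G r A ∧ A.card = n
  · obtain ⟨hA, rfl⟩ := h
    by_cases hB : ∃ j ∈ outer G A, insert j A = B
    · obtain ⟨j, hj, rfl⟩ := hB
      rw [measure_observedEvent_inter_insert hG hdeg hτ hind hlaw hA hj,
        Finset.sum_eq_single_of_mem j hj, if_pos rfl, mul_one]
      intro k hk hkj
      rw [if_neg (insert_ne_insert hk hkj)]
    · rw [Finset.sum_eq_zero, mul_zero]
      · rw [← compl_compl (observedEvent τ r A.card A ∩ _)]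
        change ∀ᵐ ω ∂P, ω ∈ (observedEvent τ r A.card A ∩ _)ᶜ
        filter_upwards [ae_observedEvent_succ hG hdeg hτ hind hlaw hA] with ω hω hωA
        obtain ⟨j, hj, hωj⟩ := hω hωA.1
        exact Set.disjoint_left.mp
          (observedEvent_disjoint τ r _ fun h => hB ⟨j, hj, h⟩) hωj hωA.2
      · intro j hj
        rw [if_neg fun h => hB ⟨j, hj, h⟩]
  · have h0 := measure_observedEvent_eq_zero hG hdeg hτ hind hlaw hn h
    rw [h0, ENNReal.zero_div, zero_mul]
    exact measure_mono_null Set.inter_subset_left h0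

/-- The expectation of a function of the network of `n` infected nodes. -/
noncomputable def networkMean (P : Measure Ω) (τ : G.edgeSet → Ω → ℝ) (r : V) (n : ℕ)
    (Φ : Finset V → ENNReal) : ENNReal :=
  ∑' A : Finset V, P (observedEvent τ r n A) * Φ A

theorem networkMean_succ (hG : G.IsTree) (hdeg : G.IsRegularOfDegree 3)
    (hτ : ∀ e, Measurable (τ e)) (hind : iIndepFun τ P)
    (hlaw : ∀ e, P.map (τ e) = expMeasure 1) (r : V) {n : ℕ} (hn : 1 ≤ n)
    (Φ : Finset V → ENNReal) :
    networkMean P τ r (n + 1) Φ =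
      networkMean P τ r n (fun A => (∑ j ∈ outer G A, Φ (insert j A)) / (n + 2 : ℕ)) := by
  simp only [networkMean]
  simp_rw [measure_observedEvent_succ hG hdeg hτ hind hlaw r hn, ← ENNReal.tsum_mul_right]
  rw [ENNReal.tsum_comm]
  refine tsum_congr fun A => ?_
  simp_rw [mul_assoc, Finset.sum_mul]
  rw [ENNReal.tsum_mul_left, Summable.tsum_finsetSum (fun _ _ => ENNReal.summable),
    div_eq_mul_inv, div_eq_mul_inv, mul_assoc, mul_comm (∑ j ∈ outer G A, Φ (insert j A))]
  congr 2
  refine Finset.sum_congr rfl fun j _ => ?_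
  rw [tsum_eq_single (insert j A) (fun B hB => by rw [if_neg hB.symm, zero_mul]), if_pos rfl,
    one_mul]

/-- The one-step equation summed over the last infected node of `B`, which is the recursion that
defines `growthCount`. -/
theorem measure_observedEvent_succ_erase (hG : G.IsTree) (hdeg : G.IsRegularOfDegree 3)
    (hτ : ∀ e, Measurable (τ e)) (hind : iIndepFun τ P)
    (hlaw : ∀ e, P.map (τ e) = expMeasure 1) (r : V) {n : ℕ} (hn : 1 ≤ n) (B : Finset V) :
    P (observedEvent τ r (n + 1) B) =
      (∑ b ∈ B.filter (fun b => b ∈ outer G (B.erase b)), P (observedEvent τ r n (B.erase b))) /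
        (n + 2 : ℕ) := by
  rw [measure_observedEvent_succ hG hdeg hτ hind hlaw r hn]
  have h1 : ∀ A : Finset V, P (observedEvent τ r n A) / (n + 2 : ℕ) *
      (∑ j ∈ outer G A, if insert j A = B then 1 else 0) =
      ∑ b ∈ B.filter (fun b => b ∈ outer G (B.erase b)),
        if A = B.erase b then P (observedEvent τ r n A) / (n + 2 : ℕ) else 0 := by
    intro A
    rw [Finset.mul_sum]
    simp_rw [mul_ite, mul_one, mul_zero]
    rw [← Finset.sum_filter, ← Finset.sum_filter]
    refine Finset.sum_congr ?_ fun _ _ => rfl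
    ext b
    simp only [Finset.mem_filter]
    constructor
    · rintro ⟨hb, rfl⟩
      have := (mem_outer.mp hb).1
      rw [Finset.erase_insert this]
      exact ⟨⟨Finset.mem_insert_self _ _, hb⟩, rfl⟩
    · rintro ⟨⟨hbB, hb⟩, rfl⟩
      exact ⟨hb, Finset.insert_erase hbB⟩
  simp_rw [h1]
  rw [Summable.tsum_finsetSum (fun _ _ => ENNReal.summable), div_eq_mul_inv, Finset.sum_mul]
  refine Finset.sum_congr rfl fun b _ => ?_
  rw [tsum_ite_eq, div_eq_mul_inv]

end Transition

/-! ### Counting infection orders -/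

section GrowthCount

variable {V : Type*} {G : SimpleGraph V} [G.LocallyFinite] [DecidableEq V]

/-- The number of orders in which the `k + 1` nodes of `A` can be infected from `r`. -/
noncomputable def growthCount (G : SimpleGraph V) [G.LocallyFinite] (r : V) : ℕ → Finset V → ℕ
  | 0, A => if A = {r} then 1 else 0
  | k + 1, A => ∑ b ∈ A.filter (fun b => b ∈ outer G (A.erase b)), growthCount G r k (A.erase b)

theorem growthCount_eq_zero {r : V} {k : ℕ} {A : Finset V} (h : r ∉ A) :
    growthCount G r k A = 0 := by
  induction k generalizing A with
  | zero =>
    rw [growthCount, if_neg]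
    rintro rfl
    exact h (Finset.mem_singleton_self r)
  | succ k ih =>
    rw [growthCount]
    exact Finset.sum_eq_zero fun b _ => ih fun hr => h (Finset.mem_of_mem_erase hr)

/-- Only `u` has neighbors on the other side, so any other node is attached to `A` through its own
part. -/
theorem mem_outer_erase_filter_iff {u : V} {A : Finset V} {p : V → Prop} [DecidablePred p]
    (hp : ∀ x y, G.Adj x y → p x → ¬ p y → x = u) {l : V} (hl : p l) (hlu : l ≠ u) :
    l ∈ outer G ((A.filter p).erase l) ↔ l ∈ outer G (A.erase l) := by
  simp only [mem_outer, Finset.mem_erase, ne_eq, not_true_eq_false, false_and, not_false_eq_true,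
    true_and, Finset.mem_filter]
  refine exists_congr fun a => ⟨fun h => ⟨⟨h.1.1, h.1.2.1⟩, h.2⟩, fun h => ?_⟩
  exact ⟨⟨h.1.1, h.1.2, by_contra fun ha => hlu (hp l a h.2 hl ha)⟩, h.2⟩

/-- Removing a last node from the part of `A` in which `p` holds, when `u` is the only node at
which this part can be entered. -/
theorem sum_erase_filter {u : V} {A : Finset V} {p : V → Prop} [DecidablePred p]
    (hp : ∀ x y, G.Adj x y → p x → ¬ p y → x = u) {f : Finset V → ℕ} {C k : ℕ}
    (hf : ∀ l ∈ A, p l → f (A.erase l) = C * growthCount G u k ((A.filter p).erase l)) :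
    ∑ l ∈ (A.filter (fun b => b ∈ outer G (A.erase b))).filter p, f (A.erase l) =
      C * growthCount G u (k + 1) (A.filter p) := by
  rw [growthCount, Finset.mul_sum, Finset.filter_comm, Finset.sum_filter,
    Finset.sum_filter (s := A.filter p)]
  refine Finset.sum_congr rfl fun l hl => ?_
  obtain ⟨hlA, hlp⟩ := Finset.mem_filter.mp hl
  rw [hf l hlA hlp]
  by_cases hlu : l = u
  · subst hlu
    rw [growthCount_eq_zero (Finset.notMem_erase l _), mul_zero, ite_self, ite_self]
  · simp only [mem_outer_erase_filter_iff hp hlp hlu]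

open Classical in
/-- Infection orders on the two sides of the edge `u`-`w` are shuffled arbitrarily, after `u`. -/
theorem growthCount_shuffle (hG : G.IsTree) {u w : V} (h : G.Adj u w) (a b : ℕ) (A : Finset V)
    (ha : (A.filter (· ∉ branch G u w)).card = a + 1)
    (hb : (A.filter (· ∈ branch G u w)).card = b + 1) :
    growthCount G u (a + b + 1) A = (a + b + 1).choose (b + 1) *
      (growthCount G u a (A.filter (· ∉ branch G u w)) *
        growthCount G w b (A.filter (· ∈ branch G u w))) := by
  have hpar : parent G u w = u := parent_of_adj_root hG h
  have hub : u ∉ branch G u w := by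
    rw [root_mem_branch_iff hG]; exact h.ne'
  have hw : ∀ x y, G.Adj x y → x ∈ branch G u w → ¬ y ∈ branch G u w → x = w :=
    fun x y hxy hx hy => (eq_of_adj_of_mem_branch hG hxy hx hy).1
  have hu : ∀ x y, G.Adj x y → x ∉ branch G u w → ¬ y ∉ branch G u w → x = u :=
    fun x y hxy hx hy => (eq_of_adj_of_mem_branch hG hxy.symm (not_not.mp hy) hx).2.trans hpar
  by_cases huA : u ∉ A
  · rw [growthCount_eq_zero huA, growthCount_eq_zero, zero_mul, mul_zero]
    exact fun hm => huA (Finset.mem_filter.mp hm).1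
  rw [not_not] at huA
  induction hn : a + b using Nat.strong_induction_on generalizing a b A with
  | _ n ih =>
  have herase : ∀ l, (A.erase l).filter (· ∉ branch G u w) = (A.filter (· ∉ branch G u w)).erase l :=
    fun l => by ext x; simp only [Finset.mem_filter, Finset.mem_erase]; tauto
  have herase' : ∀ l, (A.erase l).filter (· ∈ branch G u w) = (A.filter (· ∈ branch G u w)).erase l :=
    fun l => by ext x; simp only [Finset.mem_filter, Finset.mem_erase]; tauto
  set Au := A.filter (· ∉ branch G u w) with hAu
  set Aw := A.filter (· ∈ branch G u w) with hAw
  -- The last infected node lies on the side of `u` here and on the side of `w` in `hPw`; the two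
  -- binomials add up by Pascal's rule.
  have hPu : ∑ l ∈ (A.filter (fun b => b ∈ outer G (A.erase b))).filter (· ∉ branch G u w),
      growthCount G u n (A.erase l) =
      n.choose (b + 1) * (growthCount G u a Au * growthCount G w b Aw) := by
    cases a with
    | zero =>
      -- Only the source `u` is on its side, and it cannot be infected last; here `n = b`.
      rw [Nat.choose_eq_zero_of_lt (by lia), zero_mul]
      refine Finset.sum_eq_zero fun l hl => ?_
      have hl' : l ∈ Au := by
        rw [hAu, Finset.mem_filter]
        exact ⟨(Finset.mem_filter.mp (Finset.mem_filter.mp hl).1).1, (Finset.mem_filter.mp hl).2⟩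
      have hu' : u ∈ Au := by
        rw [hAu, Finset.mem_filter]; exact ⟨huA, hub⟩
      rw [Finset.card_le_one.mp (by lia : Au.card ≤ 1) l hl' u hu']
      exact growthCount_eq_zero (Finset.notMem_erase u A)
    | succ a =>
      rw [mul_comm (growthCount G u (a + 1) Au), ← mul_assoc]
      refine sum_erase_filter hu fun l hl hlp => ?_
      by_cases hlu : l = u
      · subst hlu
        rw [growthCount_eq_zero (Finset.notMem_erase l _),
          growthCount_eq_zero (Finset.notMem_erase l _), mul_zero]
      obtain rfl : n = a + b + 1 := by lia
      have hlAw : l ∉ Aw := by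
        rw [hAw, Finset.mem_filter]; exact fun h => hlp h.2
      rw [ih (a + b) (by lia) a b (A.erase l), herase, herase',
        Finset.erase_eq_of_notMem hlAw]
      · ring
      · rw [herase, Finset.card_erase_of_mem, ha]
        · rfl
        · rw [hAu, Finset.mem_filter]; exact ⟨hl, hlp⟩
      · rw [herase', Finset.erase_eq_of_notMem hlAw, hb]
      · exact Finset.mem_erase.mpr ⟨Ne.symm hlu, huA⟩
      · rfl
  have hPw : ∑ l ∈ (A.filter (fun b => b ∈ outer G (A.erase b))).filter (· ∈ branch G u w),
      growthCount G u n (A.erase l) =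
      n.choose b * (growthCount G u a Au * growthCount G w b Aw) := by
    -- For `b = 0` the induction hypothesis does not apply: erasing the only node beyond the edge
    -- empties that side. The order counts only if this node is `w`.
    cases b with
    | zero =>
      obtain ⟨x, hx⟩ := Finset.card_eq_one.mp hb
      have hxA : x ∈ A ∧ x ∈ branch G u w := by
        rw [← Finset.mem_filter, ← hAw, hx]; exact Finset.mem_singleton_self x
      obtain rfl : n = a := by lia
      rw [Nat.choose_zero_right, one_mul]
      have hone : ∀ l, l ∈ A ∧ l ∈ branch G u w → l = x := fun l hl => by
        rw [← Finset.mem_filter, ← hAw, hx] at hl; exact Finset.mem_singleton.mp hl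
      by_cases hxw : x = w
      · rw [hx, growthCount, if_pos (by rw [hxw]), mul_one]
        have hAx : A.erase x = Au := by
          ext y
          rw [Finset.mem_erase, hAu, Finset.mem_filter]
          refine ⟨fun hy => ⟨hy.2, fun hyb => hy.1 (hone y ⟨hy.2, hyb⟩)⟩, fun hy => ⟨?_, hy.1⟩⟩
          rintro rfl
          exact hy.2 hxA.2
        have : (A.filter (fun b => b ∈ outer G (A.erase b))).filter (· ∈ branch G u w) = {x} := by
          ext l
          rw [Finset.mem_filter, Finset.mem_filter, Finset.mem_singleton]
          refine ⟨fun hl => hone l ⟨hl.1.1, hl.2⟩, ?_⟩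
          rintro rfl
          refine ⟨⟨hxA.1, mem_outer.mpr ⟨Finset.notMem_erase l A, u, ?_, ?_⟩⟩, hxA.2⟩
          · rw [hAx, hAu, Finset.mem_filter]; exact ⟨huA, hub⟩
          · rw [hxw]; exact h.symm
        rw [this, Finset.sum_singleton, hAx]
      · rw [hx, growthCount, if_neg (by rwa [Finset.singleton_inj]), mul_zero]
        refine Finset.sum_eq_zero fun l hl => absurd ?_ hxw
        obtain ⟨hl1, hl2⟩ := Finset.mem_filter.mp hl
        obtain ⟨hl3, hl4⟩ := Finset.mem_filter.mp hl1
        obtain ⟨-, y, hy, hly⟩ := mem_outer.mp hl4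
        obtain rfl := hone l ⟨hl3, hl2⟩
        refine hw l y hly hl2 fun hyb => ?_
        exact (Finset.mem_erase.mp hy).1 (hone y ⟨(Finset.mem_erase.mp hy).2, hyb⟩)
    | succ b =>
      rw [← mul_assoc]
      refine sum_erase_filter hw fun l hl hlp => ?_
      obtain rfl : n = a + b + 1 := by lia
      have hlAu : l ∉ Au := by
        rw [hAu, Finset.mem_filter]; exact fun h => h.2 hlp
      have hlu : l ≠ u := by rintro rfl; exact hub hlp
      rw [ih (a + b) (by lia) a b (A.erase l), herase, herase',
        Finset.erase_eq_of_notMem hlAu]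
      · ring
      · rw [herase, Finset.erase_eq_of_notMem hlAu, ha]
      · rw [herase', Finset.card_erase_of_mem, hb]
        · rfl
        · rw [hAw, Finset.mem_filter]; exact ⟨hl, hlp⟩
      · exact Finset.mem_erase.mpr ⟨Ne.symm hlu, huA⟩
      · rfl
  rw [growthCount, ← Finset.sum_filter_add_sum_filter_not _ (· ∈ branch G u w), hPw, hPu,
    Nat.choose_succ_succ', add_mul]

open Classical in
/-- If no node adjacent to `x` is a likelier source than `x`, then no branch at `x` has more than
half of the nodes. -/
theorem two_mul_card_branch_le (hG : G.IsTree) {x y : V} (h : G.Adj x y) {k : ℕ} {A : Finset V}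
    (hA : A.card = k + 1) (hx : growthCount G x k A ≠ 0)
    (hmax : y ∈ A → growthCount G y k A ≤ growthCount G x k A) :
    2 * (A.filter (· ∈ branch G x y)).card ≤ k + 1 := by
  have hcard := Finset.card_filter_add_card_filter_not (s := A) (· ∈ branch G x y)
  have hxA : x ∈ A := by
    by_contra hxA; exact hx (growthCount_eq_zero hxA)
  have hpos : 0 < (A.filter (· ∉ branch G x y)).card := by
    refine Finset.card_pos.mpr ⟨x, Finset.mem_filter.mpr ⟨hxA, ?_⟩⟩
    rw [root_mem_branch_iff hG]; exact h.ne'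
  obtain ⟨a, ha⟩ := Nat.exists_eq_succ_of_ne_zero hpos.ne'
  rcases Nat.eq_zero_or_eq_succ_pred (A.filter (· ∈ branch G x y)).card with h0 | hb
  · lia
  set b := (A.filter (· ∈ branch G x y)).card.pred
  rw [Nat.succ_eq_add_one] at ha hb
  obtain rfl : k = a + b + 1 := by lia
  have hsx := growthCount_shuffle hG h a b A ha hb
  have hc := branch_compl_of_adj hG h
  have hc1 : A.filter (· ∈ branch G y x) = A.filter (· ∉ branch G x y) := by
    simp only [hc, Set.mem_compl_iff]
  have hc2 : A.filter (· ∉ branch G y x) = A.filter (· ∈ branch G x y) := by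
    simp only [hc, Set.mem_compl_iff, not_not]
  -- From `x` and from `y` the counts share the factor `R`; only the binomials differ.
  have hsy := growthCount_shuffle hG h.symm b a A (by rw [hc2, hb]) (by rw [hc1, ha])
  rw [hc1, hc2, add_comm b a] at hsy
  set R := growthCount G x a (A.filter (· ∉ branch G x y)) *
    growthCount G y b (A.filter (· ∈ branch G x y)) with hR
  have hR0 : R ≠ 0 := fun h => hx (by rw [hsx, h, mul_zero])
  have hyA : y ∈ A := by
    by_contra hyA
    refine hR0 ?_
    rw [hR, growthCount_eq_zero (A := A.filter _) (r := y) fun hm => hyA (Finset.mem_filter.mp hm).1,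
      mul_zero]
  have hle := hmax hyA
  rw [hsy, hsx, mul_comm (growthCount G y b _), ← hR] at hle
  have hle' := Nat.le_of_mul_le_mul_right hle (Nat.pos_of_ne_zero hR0)
  -- So the count from `y` is (b + 1)/(a + 1) times the count from `x`: the larger side wins.
  have hch : (a + b + 1).choose (a + 1) * (a + 1) = (a + b + 1).choose (b + 1) * (b + 1) := by
    have h1 := Nat.add_one_mul_choose_eq (a + b) a
    have h2 := Nat.add_one_mul_choose_eq (a + b) b
    rw [← h1, ← h2, ← Nat.choose_symm_add]
  have hpos' : 0 < (a + b + 1).choose (b + 1) := Nat.choose_pos (by lia)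
  have : (b + 1) ≤ (a + 1) := by
    by_contra hlt
    rw [not_le] at hlt
    have h3 : (a + b + 1).choose (a + 1) * (a + 1) < (a + b + 1).choose (b + 1) * (b + 1) :=
      lt_of_le_of_lt (Nat.mul_le_mul_right _ hle') (Nat.mul_lt_mul_of_pos_left hlt hpos')
    exact h3.ne hch
  lia

end GrowthCount

/-! ### Likeliest sources are centroids -/

section Candidates

variable {V : Type*} {G : SimpleGraph V} [G.LocallyFinite] [DecidableEq V] [Countable V]
  {Ω : Type*} [MeasurableSpace Ω] {P : Measure Ω} [IsProbabilityMeasure P]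
  {τ : G.edgeSet → Ω → ℝ}

/-- All infection orders of k + 1 nodes are equally likely, since a subtree with m nodes has m + 2
boundary nodes. The product does not depend on the source, so likelihoods compare as counts do. -/
theorem measure_observedEvent_eq_growthCount (hG : G.IsTree) (hdeg : G.IsRegularOfDegree 3)
    (hτ : ∀ e, Measurable (τ e)) (hind : iIndepFun τ P)
    (hlaw : ∀ e, P.map (τ e) = expMeasure 1) (r : V) (k : ℕ) (A : Finset V) :
    P (observedEvent τ r (k + 1) A) =
      growthCount G r k A * ∏ i ∈ Finset.range k, ((i + 1 + 2 : ℕ) : ENNReal)⁻¹ := by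
  induction k generalizing A with
  | zero =>
    rw [growthCount, Finset.prod_range_zero, mul_one]
    split_ifs with hA
    · subst hA
      rw [Nat.cast_one, ← measure_univ (μ := P)]
      refine measure_congr ?_
      filter_upwards [ae_exists_observedEvent hG hdeg hτ hind hlaw r le_rfl] with ω ⟨B, hB, hc, hω⟩
      obtain ⟨x, rfl⟩ := Finset.card_eq_one.mp hc
      obtain rfl := Finset.mem_singleton.mp hB.root_mem
      exact propext ⟨fun _ => trivial, fun _ => hω⟩
    · rw [Nat.cast_zero, measure_observedEvent_eq_zero hG hdeg hτ hind hlaw le_rfl]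
      rintro ⟨h1, h2⟩
      obtain ⟨x, rfl⟩ := Finset.card_eq_one.mp h2
      exact hA (by rw [Finset.mem_singleton.mp h1.root_mem])
  | succ k ih =>
    rw [measure_observedEvent_succ_erase hG hdeg hτ hind hlaw r (by lia) A, growthCount,
      Finset.prod_range_succ, Finset.sum_congr rfl fun b _ => ih (A.erase b), ← Finset.sum_mul,
      Nat.cast_sum, div_eq_mul_inv, mul_assoc]

open Classical in
theorem two_mul_card_branch_le_of_mem_mlCandidates (hG : G.IsTree) (hdeg : G.IsRegularOfDegree 3)
    (hτ : ∀ e, Measurable (τ e)) (hind : iIndepFun τ P)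
    (hlaw : ∀ e, P.map (τ e) = expMeasure 1) {s x : V} {n : ℕ} (hn : 1 ≤ n) {A : Finset V}
    (hA : IsRooted G s A) (hAn : A.card = n) (hpos : P (observedEvent τ s n A) ≠ 0)
    (hx : x ∈ mlCandidates P τ n A) {y : V} (hy : G.Adj x y) :
    2 * (A.filter (· ∈ branch G x y)).card ≤ n := by
  obtain ⟨k, rfl⟩ := Nat.exists_eq_add_of_le' hn
  have hxs := hx.2 s hA.root_mem
  have hm := measure_observedEvent_eq_growthCount hG hdeg hτ hind hlaw (P := P)
  refine two_mul_card_branch_le hG hy hAn ?_ ?_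
  · intro h0
    rw [hm x, h0, Nat.cast_zero, zero_mul] at hxs
    exact hpos (le_antisymm hxs bot_le)
  · intro hyA
    have h1 := hx.2 y hyA
    rw [hm x, hm y, ENNReal.mul_le_mul_iff_left] at h1
    · exact_mod_cast h1
    · exact Finset.prod_ne_zero_iff.mpr fun i _ => by simp
    · exact ENNReal.prod_ne_top fun i _ => by simp

open Classical in
-- Otherwise one edge at `x` would have the whole branch, more than half of `A`, beyond it.
theorem mem_branch_of_mem_mlCandidates (hG : G.IsTree) (hdeg : G.IsRegularOfDegree 3)
    (hτ : ∀ e, Measurable (τ e)) (hind : iIndepFun τ P)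
    (hlaw : ∀ e, P.map (τ e) = expMeasure 1) {s x v : V} {n : ℕ} (hn : 1 ≤ n) {A : Finset V}
    (hA : IsRooted G s A) (hAn : A.card = n) (hpos : P (observedEvent τ s n A) ≠ 0)
    (hx : x ∈ mlCandidates P τ n A) (hv : n < 2 * (A.filter (· ∈ branch G s v)).card) :
    x ∈ branch G s v := by
  by_contra hxv
  obtain ⟨y, hy, hsub⟩ := exists_adj_branch_subset hG hxv
  have h1 := two_mul_card_branch_le_of_mem_mlCandidates hG hdeg hτ hind hlaw hn hA hAn hpos hx hy
  have h2 : (A.filter (· ∈ branch G s v)).card ≤ (A.filter (· ∈ branch G x y)).card :=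
    Finset.card_le_card (Finset.monotone_filter_right A fun z _ hz => hsub hz)
  lia

open Classical in
-- Some edge at `x` has the complement of the branch beyond it, so this complement has at most half
-- of `A`.
theorem le_card_branch_of_mem_mlCandidates (hG : G.IsTree) (hdeg : G.IsRegularOfDegree 3)
    (hτ : ∀ e, Measurable (τ e)) (hind : iIndepFun τ P)
    (hlaw : ∀ e, P.map (τ e) = expMeasure 1) {s x v : V} (hvs : v ≠ s) {n : ℕ} (hn : 1 ≤ n)
    {A : Finset V} (hA : IsRooted G s A) (hAn : A.card = n)
    (hpos : P (observedEvent τ s n A) ≠ 0) (hx : x ∈ mlCandidates P τ n A)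
    (hxv : x ∈ branch G s v) : n ≤ 2 * (A.filter (· ∈ branch G s v)).card := by
  obtain ⟨y, hy, hsub⟩ := exists_adj_compl_branch_subset hG hvs hxv
  have h1 := two_mul_card_branch_le_of_mem_mlCandidates hG hdeg hτ hind hlaw hn hA hAn hpos hx hy
  have h2 : (A.filter (· ∉ branch G s v)).card ≤ (A.filter (· ∈ branch G x y)).card :=
    Finset.card_le_card (Finset.monotone_filter_right A fun z _ hz => hsub hz)
  have h3 := Finset.card_filter_add_card_filter_not (s := A) (· ∈ branch G s v)
  lia

omit [G.LocallyFinite] [DecidableEq V] [Countable V] [IsProbabilityMeasure P] in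
theorem mlCandidates_nonempty (n : ℕ) {A : Finset V} (hA : A.Nonempty) :
    (mlCandidates P τ n A).Nonempty := by
  obtain ⟨v, hv, hmax⟩ := A.exists_max_image (fun v => P (observedEvent τ v n A)) hA
  exact ⟨v, hv, hmax⟩

/-- The estimate almost surely is one of the maximum likelihood candidates. -/
theorem ae_mem_mlCandidates (hG : G.IsTree) (hdeg : G.IsRegularOfDegree 3)
    (hτ : ∀ e, Measurable (τ e)) (hind : iIndepFun τ P)
    (hlaw : ∀ e, P.map (τ e) = expMeasure 1) {s : V} {n : ℕ} (hn : 1 ≤ n) {W : Ω → V}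
    (hW : IsMLEstimate P τ s n W) :
    ∀ᵐ ω ∂P, ∃ A, IsRooted G s A ∧ A.card = n ∧ ω ∈ observedEvent τ s n A ∧
      P (observedEvent τ s n A) ≠ 0 ∧ W ω ∈ mlCandidates P τ n A := by
  have key : ∀ᵐ ω ∂P, ∀ A : Finset V, A.Nonempty → ω ∈ observedEvent τ s n A →
      P (observedEvent τ s n A) ≠ 0 ∧ W ω ∈ mlCandidates P τ n A := by
    rw [ae_all_iff]
    intro A
    by_cases hA : A.Nonempty
    swap
    · exact ae_of_all _ fun ω h => absurd h hA
    by_cases h0 : P (observedEvent τ s n A) = 0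
    · have : ∀ᵐ ω ∂P, ω ∉ observedEvent τ s n A := measure_eq_zero_iff_ae_notMem.mp h0
      filter_upwards [this] with ω hω _ hω' using absurd hω' hω
    have hfin : (mlCandidates P τ n A).Finite :=
      A.finite_toSet.subset fun v hv => hv.1
    set E := observedEvent τ s n A with hE
    have hEm : NullMeasurableSet E P :=
      nullMeasurableSet_observedEvent hG hdeg hτ hind hlaw hn s A
    set F : V → Set Ω := fun v => E ∩ {ω | W ω = v} with hF
    have hFm : ∀ v, NullMeasurableSet (F v) P :=
      fun v => hEm.inter (hW.measurableSet_fiber v).nullMeasurableSet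
    -- The equal shares of the candidates add up to `P E`, leaving no mass for other values of `W`.
    have hU : P (⋃ v ∈ hfin.toFinset, F v) = P E := by
      rw [measure_biUnion_finset₀ (fun v _ w _ hvw => ?_) (fun v _ => hFm v)]
      · rw [Finset.sum_congr rfl fun v hv => hW.prob_eq A v (hfin.mem_toFinset.mp hv),
          Finset.sum_const, nsmul_eq_mul, Set.ncard_eq_toFinset_card _ hfin]
        refine ENNReal.mul_div_cancel ?_ (by simp)
        rw [Nat.cast_ne_zero, Finset.card_ne_zero, hfin.toFinset_nonempty]
        exact mlCandidates_nonempty n hA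
      · refine Disjoint.aedisjoint (Set.disjoint_left.mpr fun ω h1 h2 => hvw ?_)
        exact (Eq.symm h1.2).trans h2.2
    have hae : (⋃ v ∈ hfin.toFinset, F v) =ᵐ[P] E :=
      ae_eq_of_subset_of_measure_ge (Set.iUnion₂_subset fun v _ => Set.inter_subset_left) hU.ge
        (NullMeasurableSet.biUnion (Finset.countable_toSet _) fun v _ => hFm v)
        (measure_ne_top _ _)
    filter_upwards [hae] with ω hω _ hωE
    have : ω ∈ ⋃ v ∈ hfin.toFinset, F v := (Eq.symm hω).mp hωE
    simp only [Set.mem_iUnion, exists_prop] at this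
    obtain ⟨v, hv, hvF⟩ := this
    refine ⟨h0, ?_⟩
    rw [show W ω = v from hvF.2]
    exact hfin.mem_toFinset.mp hv
  filter_upwards [key, ae_exists_observedEvent hG hdeg hτ hind hlaw s hn] with ω h ⟨A, hA, hc, hω⟩
  exact ⟨A, hA, hc, hω, h A ⟨s, hA.root_mem⟩ hω⟩

end Candidates

/-! ### Branch sizes as urns -/

section BranchCard

variable {V : Type*} {G : SimpleGraph V}

open Classical in
/-- The number of nodes of `A` in the branch of `v`, seen from the root `r`. -/
noncomputable def branchCard (G : SimpleGraph V) (r v : V) (A : Finset V) : ℕ :=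
  (A.filter (· ∈ branch G r v)).card

open Classical in
theorem branchCard_le_card (r v : V) (A : Finset V) : branchCard G r v A ≤ A.card :=
  Finset.card_filter_le _ _

theorem branch_subset_branch_parent (hG : G.IsTree) (r v : V) :
    branch G r v ⊆ branch G r (parent G r v) := by
  intro x hx
  induction x using parent_induction hG r with
  | root =>
    rw [root_mem_branch_iff hG] at hx
    rw [hx, parent_root]
    exact self_mem_branch _ _
  | step x hxr ih =>
    by_cases hxv : x = v
    · subst hxv; exact mem_branch_of_parent hG (self_mem_branch _ _)
    · exact mem_branch_of_parent hG (ih (parent_mem_branch hG hx hxv))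

open Classical in
theorem IsRooted.mem_of_branchCard_pos (hG : G.IsTree) {r v : V} {A : Finset V}
    (hA : IsRooted G r A) (h : 0 < branchCard G r v A) : v ∈ A := by
  obtain ⟨x, hx⟩ := Finset.card_pos.mp h
  obtain ⟨hxA, hxv⟩ := Finset.mem_filter.mp hx
  clear hx
  induction x using parent_induction hG r with
  | root =>
    rw [root_mem_branch_iff hG] at hxv
    exact hxv ▸ hxA
  | step x hxr ih =>
    by_cases h : x = v
    · exact h ▸ hxA
    · exact ih (hA.parent_mem x hxA) (parent_mem_branch hG hxv h)

open Classical in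
theorem branchCard_le_parent (hG : G.IsTree) (r v : V) (A : Finset V) :
    branchCard G r v A ≤ branchCard G r (parent G r v) A :=
  Finset.card_le_card (Finset.monotone_filter_right A
    fun _ _ hx => branch_subset_branch_parent hG r v hx)

open Classical in
theorem IsRooted.branchCard_lt_parent (hG : G.IsTree) {r v : V} (hv : v ≠ r) {A : Finset V}
    (hA : IsRooted G r A) (h : 0 < branchCard G r (parent G r v) A) :
    branchCard G r v A < branchCard G r (parent G r v) A := by
  have hp := hA.mem_of_branchCard_pos hG h
  refine Finset.card_lt_card (Finset.ssubset_iff_of_subset (Finset.monotone_filter_right A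
    fun _ _ hx => branch_subset_branch_parent hG r v hx) |>.mpr ⟨parent G r v, ?_, ?_⟩)
  · exact Finset.mem_filter.mpr ⟨hp, self_mem_branch _ _⟩
  · exact fun hm => not_mem_branch_parent hG hv (Finset.mem_filter.mp hm).2

variable [G.LocallyFinite] [DecidableEq V]

open Classical in
theorem branchCard_insert {r v j : V} {A : Finset V} (hj : j ∈ outer G A) :
    branchCard G r v (insert j A) = branchCard G r v A + if j ∈ branch G r v then 1 else 0 := by
  have hjA := (mem_outer.mp hj).1
  rw [branchCard, branchCard]
  split_ifs with h
  · rw [show (insert j A).filter (· ∈ branch G r v) = insert j (A.filter (· ∈ branch G r v)) by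
      ext x; simp only [Finset.mem_filter, Finset.mem_insert]; grind,
      Finset.card_insert_of_notMem fun hm => hjA (Finset.mem_filter.mp hm).1]
  · rw [show (insert j A).filter (· ∈ branch G r v) = A.filter (· ∈ branch G r v) by
      ext x; simp only [Finset.mem_filter, Finset.mem_insert]; grind, add_zero]

open Classical in
theorem IsRooted.card_filter_not_branch (hG : G.IsTree) (hdeg : G.IsRegularOfDegree 3)
    {r v : V} (hv : v ≠ r) {A : Finset V} (hA : IsRooted G r A) (hp : parent G r v ∈ A) :
    ((outer G A).filter (· ∉ branch G r v)).card + branchCard G r v A = A.card + 1 := by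
  have h1 := Finset.card_filter_add_card_filter_not (s := outer G A) (· ∈ branch G r v)
  have h2 := hA.card_outer_branch hG hdeg hv hp
  have h3 := hA.card_outer hG hdeg
  rw [branchCard]
  lia

open Classical in
theorem card_filter_branchCard_zero (hG : G.IsTree) (hdeg : G.IsRegularOfDegree 3)
    {r v : V} (hv : v ≠ r) {A : Finset V} (hA : IsRooted G r A) (hp : parent G r v ∈ A) :
    ((outer G A).filter fun j => branchCard G r v (insert j A) = 0).card =
      (A.card + 1) * if branchCard G r v A = 0 then 1 else 0 := by
  have h1 := hA.card_filter_not_branch hG hdeg hv hp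
  rw [Finset.filter_congr (q := fun j => branchCard G r v A = 0 ∧ j ∉ branch G r v)]
  · by_cases h0 : branchCard G r v A = 0
    · simp only [h0, true_and, if_pos]
      lia
    · simp [h0]
  · intro j hj
    rw [branchCard_insert hj]
    split_ifs with h <;> simp [h]

open Classical in
-- A branch with x nodes is entered through x + 1 boundary nodes; a branch with x + 1 nodes is
-- missed by |A| - x. The hypothesis `hp` excludes a branch that cannot be entered yet because the
-- parent of `v` is not infected.
theorem card_filter_branchCard_succ (hG : G.IsTree) (hdeg : G.IsRegularOfDegree 3)
    {r v : V} (hv : v ≠ r) {A : Finset V} (hA : IsRooted G r A) {x : ℕ}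
    (hp : 1 ≤ x ∨ parent G r v ∈ A) :
    ((outer G A).filter fun j => branchCard G r v (insert j A) = x + 1).card =
      (x + 1) * (if branchCard G r v A = x then 1 else 0) +
      (A.card - x) * (if branchCard G r v A = x + 1 then 1 else 0) := by
  rw [Finset.filter_congr (q := fun j => (branchCard G r v A = x ∧ j ∈ branch G r v) ∨
    (branchCard G r v A = x + 1 ∧ j ∉ branch G r v))]
  swap
  · intro j hj
    rw [branchCard_insert hj]
    split_ifs with h <;> simp [h]
  have hpar : 0 < branchCard G r v A → parent G r v ∈ A := fun h =>
    hA.parent_mem v (hA.mem_of_branchCard_pos hG h)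
  by_cases h0 : branchCard G r v A = x
  · have hp' : parent G r v ∈ A := hp.elim (fun h => hpar (by lia)) id
    have h2 := hA.card_outer_branch hG hdeg hv hp'
    simp [h0, h2]
    exact h0
  · by_cases h1 : branchCard G r v A = x + 1
    · have h2 := hA.card_filter_not_branch hG hdeg hv (hpar (by lia))
      simp [h1]
      lia
    · simp [h0, h1]

open Classical in
-- The three terms are the ways to reach the sizes (x + 1, y): the new node lies in the branch of
-- `v`, in that of its parent only, or in neither.
theorem card_filter_branchCard_pair (hG : G.IsTree) (hdeg : G.IsRegularOfDegree 3)
    {r v : V} (hv : v ≠ r) (hu : parent G r v ≠ r) {A : Finset V} (hA : IsRooted G r A) {x y : ℕ}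
    (hx : 1 ≤ x) :
    ((outer G A).filter fun j => branchCard G r (parent G r v) (insert j A) = x + 1 ∧
        branchCard G r v (insert j A) = y).card =
      y * (if branchCard G r (parent G r v) A = x ∧ branchCard G r v A + 1 = y then 1 else 0) +
      (x - y) * (if branchCard G r (parent G r v) A = x ∧ branchCard G r v A = y then 1 else 0) +
      (A.card - x) *
        (if branchCard G r (parent G r v) A = x + 1 ∧ branchCard G r v A = y then 1 else 0) := by
  set u := parent G r v with hudef
  have hvu : ∀ j, j ∈ branch G r v → j ∈ branch G r u :=
    fun j hj => branch_subset_branch_parent hG r v hj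
  by_cases hpos : 0 < branchCard G r u A
  swap
  · rw [if_neg (by lia), if_neg (by lia), if_neg (by lia), Finset.filter_false_of_mem]
    · simp
    · intro j hj
      rw [branchCard_insert hj]
      split_ifs <;> lia
  have huA : u ∈ A := hA.mem_of_branchCard_pos hG hpos
  have hlt := hA.branchCard_lt_parent hG hv hpos
  rw [← hudef] at hlt
  have hBu := hA.card_outer_branch hG hdeg hu (hA.parent_mem u huA)
  have hBu' := hA.card_filter_not_branch hG hdeg hu (hA.parent_mem u huA)
  have hBv := hA.card_outer_branch hG hdeg hv huA
  change _ = branchCard G r u A + 1 at hBu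
  change _ = branchCard G r v A + 1 at hBv
  have hdiff : ((outer G A).filter fun j => j ∈ branch G r u ∧ j ∉ branch G r v).card +
      (branchCard G r v A + 1) = branchCard G r u A + 1 := by
    rw [← hBu, ← hBv, ← Finset.card_filter_add_card_filter_not
      (s := (outer G A).filter (· ∈ branch G r u)) (· ∈ branch G r v), add_comm,
      Finset.filter_filter, Finset.filter_filter]
    congr 2
    exact Finset.filter_congr fun j _ => ⟨fun h => ⟨hvu j h, h⟩, fun h => h.2⟩
  rw [Finset.filter_congr (q := fun j =>
    (branchCard G r u A = x ∧ branchCard G r v A + 1 = y) ∧ j ∈ branch G r v ∨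
    (branchCard G r u A = x ∧ branchCard G r v A = y) ∧ (j ∈ branch G r u ∧ j ∉ branch G r v) ∨
    (branchCard G r u A = x + 1 ∧ branchCard G r v A = y) ∧ j ∉ branch G r u)]
  swap
  · intro j hj
    have := hvu j
    rw [branchCard_insert hj, branchCard_insert hj]
    by_cases h1 : j ∈ branch G r v
    · simp [h1, this h1]
    · by_cases h2 : j ∈ branch G r u <;> simp [h1, h2]
  by_cases h1 : branchCard G r u A = x ∧ branchCard G r v A + 1 = y
  · have h2 : ¬ (branchCard G r u A = x ∧ branchCard G r v A = y) := by lia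
    have h3 : ¬ (branchCard G r u A = x + 1 ∧ branchCard G r v A = y) := by lia
    rw [if_pos h1, if_neg h2, if_neg h3, Finset.filter_congr (q := (· ∈ branch G r v))]
    · lia
    · intro j _; tauto
  · by_cases h2 : branchCard G r u A = x ∧ branchCard G r v A = y
    · have h3 : ¬ (branchCard G r u A = x + 1 ∧ branchCard G r v A = y) := by lia
      rw [if_neg h1, if_pos h2, if_neg h3,
        Finset.filter_congr (q := fun j => j ∈ branch G r u ∧ j ∉ branch G r v)]
      · lia
      · intro j _; tauto
    · by_cases h3 : branchCard G r u A = x + 1 ∧ branchCard G r v A = y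
      · rw [if_neg h1, if_neg h2, if_pos h3, Finset.filter_congr (q := (· ∉ branch G r u))]
        · lia
        · intro j _; tauto
      · rw [if_neg h1, if_neg h2, if_neg h3, Finset.filter_false_of_mem]
        · simp
        · intro j _; tauto

end BranchCard

/-! ### Exact laws of the branch sizes -/

section NetworkProb

variable {V : Type*} {G : SimpleGraph V} {Ω : Type*} [MeasurableSpace Ω]
  {P : Measure Ω} {τ : G.edgeSet → Ω → ℝ}

open Classical in
/-- The probability that the network of `n` infected nodes has the property `p`. -/
noncomputable def networkProb (P : Measure Ω) (τ : G.edgeSet → Ω → ℝ) (r : V) (n : ℕ)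
    (p : Finset V → Prop) : ℝ :=
  (networkMean P τ r n fun A => if p A then 1 else 0).toReal

variable [G.LocallyFinite] [DecidableEq V] [Countable V] [IsProbabilityMeasure P]

theorem networkMean_congr (hG : G.IsTree) (hdeg : G.IsRegularOfDegree 3)
    (hτ : ∀ e, Measurable (τ e)) (hind : iIndepFun τ P)
    (hlaw : ∀ e, P.map (τ e) = expMeasure 1) {r : V} {n : ℕ} (hn : 1 ≤ n)
    {Φ Ψ : Finset V → ENNReal} (h : ∀ A, IsRooted G r A → A.card = n → Φ A = Ψ A) :
    networkMean P τ r n Φ = networkMean P τ r n Ψ := by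
  refine tsum_congr fun A => ?_
  by_cases hA : IsRooted G r A ∧ A.card = n
  · rw [h A hA.1 hA.2]
  · rw [measure_observedEvent_eq_zero hG hdeg hτ hind hlaw hn hA, zero_mul, zero_mul]

open Classical in
/-- A property of the network is an event. -/
theorem networkMean_eq_measure (hG : G.IsTree) (hdeg : G.IsRegularOfDegree 3)
    (hτ : ∀ e, Measurable (τ e)) (hind : iIndepFun τ P)
    (hlaw : ∀ e, P.map (τ e) = expMeasure 1) (r : V) {n : ℕ} (hn : 1 ≤ n)
    (p : Finset V → Prop) :
    networkMean P τ r n (fun A => if p A then 1 else 0) =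
      P {ω | ∃ A, p A ∧ ω ∈ observedEvent τ r n A} := by
  have : {ω | ∃ A, p A ∧ ω ∈ observedEvent τ r n A} =
      ⋃ A : Finset V, if p A then observedEvent τ r n A else ∅ := by
    ext ω
    simp only [Set.mem_ofPred_eq, Set.mem_iUnion]
    refine exists_congr fun A => ?_
    split_ifs with h <;> simp [h]
  rw [this, measure_iUnion₀]
  · refine tsum_congr fun A => ?_
    by_cases h : p A <;> simp [h]
  · intro A B hAB
    refine Disjoint.aedisjoint ?_
    beta_reduce
    split_ifs
    · exact observedEvent_disjoint τ r n hAB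
    all_goals simp
  · intro A
    split_ifs
    · exact nullMeasurableSet_observedEvent hG hdeg hτ hind hlaw hn r A
    · exact nullMeasurableSet_empty

theorem networkProb_eq_measureReal (hG : G.IsTree) (hdeg : G.IsRegularOfDegree 3)
    (hτ : ∀ e, Measurable (τ e)) (hind : iIndepFun τ P)
    (hlaw : ∀ e, P.map (τ e) = expMeasure 1) (r : V) {n : ℕ} (hn : 1 ≤ n)
    (p : Finset V → Prop) :
    networkProb P τ r n p = P.real {ω | ∃ A, p A ∧ ω ∈ observedEvent τ r n A} := by
  rw [networkProb, networkMean_eq_measure hG hdeg hτ hind hlaw r hn, Measure.real]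

open Classical in
theorem networkMean_indicator_ne_top (hG : G.IsTree) (hdeg : G.IsRegularOfDegree 3)
    (hτ : ∀ e, Measurable (τ e)) (hind : iIndepFun τ P)
    (hlaw : ∀ e, P.map (τ e) = expMeasure 1) (r : V) {n : ℕ} (hn : 1 ≤ n)
    (p : Finset V → Prop) :
    networkMean P τ r n (fun A => if p A then 1 else 0) ≠ ⊤ := by
  rw [networkMean_eq_measure hG hdeg hτ hind hlaw r hn]
  exact measure_ne_top _ _

theorem networkProb_congr (hG : G.IsTree) (hdeg : G.IsRegularOfDegree 3)
    (hτ : ∀ e, Measurable (τ e)) (hind : iIndepFun τ P)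
    (hlaw : ∀ e, P.map (τ e) = expMeasure 1) {r : V} {n : ℕ} (hn : 1 ≤ n)
    {p q : Finset V → Prop} (h : ∀ A, IsRooted G r A → A.card = n → (p A ↔ q A)) :
    networkProb P τ r n p = networkProb P τ r n q := by
  classical
  rw [networkProb, networkProb]
  congr 1
  refine networkMean_congr hG hdeg hτ hind hlaw hn fun A h1 h2 => ?_
  simp only [h A h1 h2]

theorem networkProb_eq_zero (hG : G.IsTree) (hdeg : G.IsRegularOfDegree 3)
    (hτ : ∀ e, Measurable (τ e)) (hind : iIndepFun τ P)
    (hlaw : ∀ e, P.map (τ e) = expMeasure 1) {r : V} {n : ℕ} (hn : 1 ≤ n)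
    {p : Finset V → Prop} (h : ∀ A, IsRooted G r A → A.card = n → ¬ p A) :
    networkProb P τ r n p = 0 := by
  rw [networkProb_congr hG hdeg hτ hind hlaw hn (q := fun _ => False)
    fun A h1 h2 => iff_false_intro (h A h1 h2)]
  simp [networkProb, networkMean]

theorem networkProb_eq_one (hG : G.IsTree) (hdeg : G.IsRegularOfDegree 3)
    (hτ : ∀ e, Measurable (τ e)) (hind : iIndepFun τ P)
    (hlaw : ∀ e, P.map (τ e) = expMeasure 1) {r : V} {n : ℕ} (hn : 1 ≤ n)
    {p : Finset V → Prop} (h : ∀ A, IsRooted G r A → A.card = n → p A) :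
    networkProb P τ r n p = 1 := by
  rw [networkProb_eq_measureReal hG hdeg hτ hind hlaw r hn, ← probReal_univ (μ := P)]
  refine measureReal_congr ?_
  filter_upwards [ae_exists_observedEvent hG hdeg hτ hind hlaw r hn] with ω ⟨A, h1, h2, h3⟩
  exact propext ⟨fun _ => trivial, fun _ => ⟨A, h A h1 h2, h3⟩⟩

/-- Splitting a property of the network by the value of a statistic. -/
theorem networkProb_fiber (hG : G.IsTree) (hdeg : G.IsRegularOfDegree 3)
    (hτ : ∀ e, Measurable (τ e)) (hind : iIndepFun τ P)
    (hlaw : ∀ e, P.map (τ e) = expMeasure 1) {r : V} {n : ℕ} (hn : 1 ≤ n)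
    {p : Finset V → Prop} (f : Finset V → ℕ) (S : Finset ℕ)
    (h : ∀ A, IsRooted G r A → A.card = n → p A → f A ∈ S) :
    networkProb P τ r n p = ∑ i ∈ S, networkProb P τ r n fun A => f A = i ∧ p A := by
  classical
  simp only [networkProb]
  rw [← ENNReal.toReal_sum
    fun i _ => networkMean_indicator_ne_top hG hdeg hτ hind hlaw r hn _]
  simp only [networkMean]
  rw [← Summable.tsum_finsetSum (fun _ _ => ENNReal.summable)]
  congr 1
  simp_rw [← Finset.mul_sum]
  refine networkMean_congr hG hdeg hτ hind hlaw hn fun A h1 h2 => ?_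
  by_cases hp : p A
  · simp [hp, h A h1 h2 hp]
  · simp [hp]

open Classical in
/-- The evolution of the probability of a property when the next node gets the rumor. -/
theorem networkProb_succ (hG : G.IsTree) (hdeg : G.IsRegularOfDegree 3)
    (hτ : ∀ e, Measurable (τ e)) (hind : iIndepFun τ P)
    (hlaw : ∀ e, P.map (τ e) = expMeasure 1) {r : V} {n : ℕ} (hn : 1 ≤ n)
    {p : Finset V → Prop} {ι : Type*} (S : Finset ι) (c : ι → ℕ) (q : ι → Finset V → Prop)
    (h : ∀ A, IsRooted G r A → A.card = n →
      ((outer G A).filter fun j => p (insert j A)).card =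
        ∑ i ∈ S, c i * if q i A then 1 else 0) :
    (n + 2 : ℝ) * networkProb P τ r (n + 1) p = ∑ i ∈ S, c i * networkProb P τ r n (q i) := by
  have hfin := networkMean_indicator_ne_top hG hdeg hτ hind hlaw r hn (P := P)
  have key : networkMean P τ r (n + 1) (fun A => if p A then 1 else 0) * (n + 2 : ℕ) =
      ∑ i ∈ S, c i * networkMean P τ r n fun A => if q i A then 1 else 0 := by
    rw [networkMean_succ hG hdeg hτ hind hlaw r hn]
    simp only [networkMean]
    simp_rw [← ENNReal.tsum_mul_left]
    rw [← Summable.tsum_finsetSum (fun _ _ => ENNReal.summable), ← ENNReal.tsum_mul_right]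
    refine tsum_congr fun A => ?_
    by_cases hA : IsRooted G r A ∧ A.card = n
    · rw [mul_assoc, ENNReal.div_mul_cancel (by simp) (by simp), ← Finset.sum_filter,
        Finset.sum_const, nsmul_one, h A hA.1 hA.2, Nat.cast_sum, Finset.mul_sum]
      refine Finset.sum_congr rfl fun i _ => ?_
      push_cast
      ring
    · rw [measure_observedEvent_eq_zero hG hdeg hτ hind hlaw hn hA]
      simp
  have := congrArg ENNReal.toReal key
  rw [ENNReal.toReal_mul, ENNReal.toReal_sum
    (fun i _ => ENNReal.mul_ne_top (by simp) (hfin (q i)))] at this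
  simp only [ENNReal.toReal_mul, ENNReal.toReal_natCast] at this
  rw [mul_comm]
  push_cast at this
  exact this

/-- The law of the number of nodes in the branch of a neighbor of the source. -/
theorem networkProb_branchCard_of_adj (hG : G.IsTree) (hdeg : G.IsRegularOfDegree 3)
    (hτ : ∀ e, Measurable (τ e)) (hind : iIndepFun τ P)
    (hlaw : ∀ e, P.map (τ e) = expMeasure 1) {r v : V} (hv : G.Adj r v) {n : ℕ} (hn : 1 ≤ n)
    {y : ℕ} (hy : y ≤ n) :
    networkProb P τ r n (fun A => branchCard G r v A = y) =
      2 * ((n : ℝ) - y) / (n * (n + 1)) := by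
  classical
  have hp : parent G r v = r := parent_of_adj_root hG hv
  induction n, hn using Nat.le_induction generalizing y with
  | base =>
    have h0 : ∀ A, IsRooted G r A → A.card = 1 → branchCard G r v A = 0 := by
      intro A hA hc
      by_contra h
      have hvA := hA.mem_of_branchCard_pos hG (Nat.pos_of_ne_zero h)
      exact hv.ne (Finset.card_le_one.mp hc.le r hA.root_mem v hvA)
    rcases Nat.le_one_iff_eq_zero_or_eq_one.mp hy with rfl | rfl
    · rw [networkProb_eq_one hG hdeg hτ hind hlaw le_rfl h0]
      norm_num
    · rw [networkProb_eq_zero hG hdeg hτ hind hlaw le_rfl fun A h1 h2 => by rw [h0 A h1 h2]; simp]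
      norm_num
  | succ n hn ih =>
    have hn0 : (0 : ℝ) < n := by exact_mod_cast hn
    cases y with
    | zero =>
      have h := networkProb_succ hG hdeg hτ hind hlaw hn (p := fun A => branchCard G r v A = 0)
        {()} (fun _ => n + 1) (fun _ A => branchCard G r v A = 0) fun A hA hc => by
          subst hc
          rw [Finset.sum_singleton]
          convert card_filter_branchCard_zero hG hdeg hv.ne' hA (by rw [hp]; exact hA.root_mem)
      rw [Finset.sum_singleton, ih (Nat.zero_le _)] at h
      have h2 : (0 : ℝ) < n + 2 := by positivity
      rw [← mul_right_inj' h2.ne', h]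
      push_cast
      field_simp
      ring
    | succ x =>
      have h := networkProb_succ hG hdeg hτ hind hlaw hn (p := fun A => branchCard G r v A = x + 1)
        (Finset.univ : Finset (Fin 2)) ![x + 1, n - x]
        ![fun A => branchCard G r v A = x, fun A => branchCard G r v A = x + 1] fun A hA hc => by
          subst hc
          simp only [Fin.sum_univ_two, Matrix.cons_val_zero, Matrix.cons_val_one]
          convert card_filter_branchCard_succ hG hdeg hv.ne' hA
            (.inr (by rw [hp]; exact hA.root_mem))
          all_goals congr
      have hx : x ≤ n := by lia
      -- At `x = n` the size `x + 1` is out of reach of the induction hypothesis, but its weight is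
      -- 0.
      have h3 : ((n - x : ℕ) : ℝ) * networkProb P τ r n (fun A => branchCard G r v A = x + 1) =
          ((n : ℝ) - x) * (2 * ((n : ℝ) - (x + 1)) / (n * (n + 1))) := by
        rcases hx.eq_or_lt with rfl | hx
        · simp
        · rw [ih (y := x + 1) hx, Nat.cast_sub hx.le]
          push_cast
          rfl
      simp only [Fin.sum_univ_two, Matrix.cons_val_zero, Matrix.cons_val_one] at h
      rw [h3, ih hx] at h
      have h2 : (0 : ℝ) < n + 2 := by positivity
      rw [← mul_right_inj' h2.ne', h]
      push_cast
      field_simp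
      ring

/-- Given that the branch of a node other than the source has `x ≥ 1` nodes, the number of nodes
in the branch of a child is uniformly distributed on `0, …, x - 1`. -/
theorem networkProb_branchCard_pair (hG : G.IsTree) (hdeg : G.IsRegularOfDegree 3)
    (hτ : ∀ e, Measurable (τ e)) (hind : iIndepFun τ P)
    (hlaw : ∀ e, P.map (τ e) = expMeasure 1) {r v : V} (hv : v ≠ r) (hu : parent G r v ≠ r)
    {n : ℕ} (hn : 1 ≤ n) {x y : ℕ} (hxy : y < x) :
    x * networkProb P τ r n
        (fun A => branchCard G r (parent G r v) A = x ∧ branchCard G r v A = y) =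
      networkProb P τ r n (fun A => branchCard G r (parent G r v) A = x) := by
  classical
  induction n, hn using Nat.le_induction generalizing x y with
  | base =>
    have h0 : ∀ A, IsRooted G r A → A.card = 1 → branchCard G r (parent G r v) A ≠ x := by
      intro A hA hc h
      have hvA := hA.mem_of_branchCard_pos hG (v := parent G r v) (by lia)
      exact hu (Finset.card_le_one.mp hc.le _ hvA r hA.root_mem)
    rw [networkProb_eq_zero hG hdeg hτ hind hlaw le_rfl fun A h1 h2 h => h0 A h1 h2 h.1,
      networkProb_eq_zero hG hdeg hτ hind hlaw le_rfl h0, mul_zero]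
  | succ n hn ih =>
    obtain ⟨x, rfl⟩ : ∃ z, x = z + 1 := ⟨x - 1, by lia⟩
    rcases Nat.eq_zero_or_pos x with rfl | hx
    -- If the parent's branch is a single node, the child's branch is empty.
    · obtain rfl : y = 0 := by lia
      rw [zero_add, Nat.cast_one, one_mul]
      refine networkProb_congr hG hdeg hτ hind hlaw (by lia) fun A hA _ => ⟨fun h => h.1, fun h => ?_⟩
      have := hA.branchCard_lt_parent hG hv (by lia)
      exact ⟨h, by lia⟩
    have h1 := networkProb_succ hG hdeg hτ hind hlaw hn
      (p := fun A => branchCard G r (parent G r v) A = x + 1 ∧ branchCard G r v A = y)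
      (Finset.univ : Finset (Fin 3)) ![y, x - y, n - x]
      ![fun A => branchCard G r (parent G r v) A = x ∧ branchCard G r v A + 1 = y,
        fun A => branchCard G r (parent G r v) A = x ∧ branchCard G r v A = y,
        fun A => branchCard G r (parent G r v) A = x + 1 ∧ branchCard G r v A = y]
      fun A hA hc => by
        subst hc
        simp only [Fin.sum_univ_three, Matrix.cons_val_zero, Matrix.cons_val_one, Matrix.cons_val]
        convert card_filter_branchCard_pair hG hdeg hv hu hA hx
        all_goals congr
    have h2 := networkProb_succ hG hdeg hτ hind hlaw hn
      (p := fun A => branchCard G r (parent G r v) A = x + 1)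
      (Finset.univ : Finset (Fin 2)) ![x + 1, n - x]
      ![fun A => branchCard G r (parent G r v) A = x,
        fun A => branchCard G r (parent G r v) A = x + 1]
      fun A hA hc => by
        subst hc
        simp only [Fin.sum_univ_two, Matrix.cons_val_zero, Matrix.cons_val_one]
        convert card_filter_branchCard_succ hG hdeg hu hA (.inl hx)
        all_goals congr
    simp only [Fin.sum_univ_three, Fin.sum_univ_two, Matrix.cons_val_zero, Matrix.cons_val_one,
      Matrix.cons_val] at h1 h2
    have hq := ih hxy
    set a := networkProb P τ r n (fun A => branchCard G r (parent G r v) A = x)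
    set b := networkProb P τ r n (fun A => branchCard G r (parent G r v) A = x + 1)
    have hx0 : (0 : ℝ) < x := by exact_mod_cast hx
    -- Uniformity at time n gives the terms `y * a` and `(x - y) * a`, whose sum no longer depends
    -- on `y`. In the cases outside the induction hypothesis, `y = 0` here and `y = x` in `t2`, the
    -- weights vanish.
    have t1 : x * ((y : ℝ) * networkProb P τ r n
        (fun A => branchCard G r (parent G r v) A = x ∧ branchCard G r v A + 1 = y)) = y * a := by
      cases y with
      | zero => simp
      | succ y =>
        have : _ = a := ih (x := x) (y := y) (by lia)
        simp only [Nat.add_right_cancel_iff]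
        rw [← this]
        ring
    have t2 : x * (((x - y : ℕ) : ℝ) * networkProb P τ r n
        (fun A => branchCard G r (parent G r v) A = x ∧ branchCard G r v A = y)) =
        (x - y) * a := by
      rcases (show y ≤ x by lia).eq_or_lt with rfl | hlt
      · simp
      · have : _ = a := ih hlt
        rw [Nat.cast_sub hlt.le, ← this]
        ring
    have hn2 : (0 : ℝ) < n + 2 := by positivity
    have hxn : (0 : ℝ) < x * (n + 2) := by positivity
    rw [← mul_right_inj' hxn.ne']
    push_cast at h1 h2 hq ⊢
    calc _ = (x + 1) * (x * ((n + 2) * networkProb P τ r (n + 1)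
          fun A => branchCard G r (parent G r v) A = x + 1 ∧ branchCard G r v A = y)) := by ring
      _ = (x + 1) * (y * a + (x - y) * a) + x * ((n - x : ℕ) : ℝ) * b := by
        rw [h1, ← t1, ← t2, ← hq]; ring
      _ = x * ((x + 1) * a + ((n - x : ℕ) : ℝ) * b) := by ring
      _ = _ := by rw [← h2]; ring

end NetworkProb

/-! ### Limits of the branch laws -/

section Asymptotics

/-- The probability that the branch of a node at distance `d + 1` from the source contains `y ≥ 1`
of the `n` nodes of the network. -/
noncomputable def branchLaw : ℕ → ℕ → ℕ → ℝ
  | 0, n, y => 2 * ((n : ℝ) - y) / (n * (n + 1))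
  | d + 1, n, y => ∑ x ∈ Finset.Ioc y n, branchLaw d n x / x

/-- The sum of `1 / (x₁ ⋯ x_d)` over `y < x₁ < ⋯ < x_d ≤ n`. -/
noncomputable def nestedSum : ℕ → ℕ → ℕ → ℝ
  | 0, _, _ => 1
  | d + 1, n, y => ∑ x ∈ Finset.Ioc y n, nestedSum d n x / x

/-- For `d = 0` this is (n - x)/x = n/x - 1, summed; the -1 produces `branchLaw 0`. Both sides then
obey the same recursion in `d`. -/
theorem branchLaw_succ_add {n : ℕ} (hn : 1 ≤ n) (d : ℕ) {y : ℕ} (hy : y ≤ n) :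
    branchLaw (d + 1) n y + branchLaw d n y = 2 / (n + 1) * nestedSum (d + 1) n y := by
  have hn0 : (0 : ℝ) < n := by exact_mod_cast hn
  induction d generalizing y with
  | zero =>
    simp only [branchLaw, nestedSum]
    have h1 : ∀ x ∈ Finset.Ioc y n, 2 * ((n : ℝ) - x) / (n * (n + 1)) / x =
        2 / (n + 1) * (1 / x) - 2 / (n * (n + 1)) := by
      intro x hx
      have : (0 : ℝ) < x := by
        exact_mod_cast (Nat.zero_le y).trans_lt (Finset.mem_Ioc.mp hx).1
      field_simp
    rw [Finset.sum_congr rfl h1, Finset.sum_sub_distrib, ← Finset.mul_sum, Finset.sum_const,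
      Nat.card_Ioc, nsmul_eq_mul, Nat.cast_sub hy]
    ring
  | succ d ih =>
    have e1 : branchLaw (d + 1 + 1) n y = ∑ x ∈ Finset.Ioc y n, branchLaw (d + 1) n x / x := rfl
    have e2 : branchLaw (d + 1) n y = ∑ x ∈ Finset.Ioc y n, branchLaw d n x / x := rfl
    have e3 : nestedSum (d + 1 + 1) n y = ∑ x ∈ Finset.Ioc y n, nestedSum (d + 1) n x / x := rfl
    rw [e1, e2, e3, ← Finset.sum_add_distrib, Finset.mul_sum]
    refine Finset.sum_congr rfl fun x hx => ?_
    rw [← add_div, ih (Finset.mem_Ioc.mp hx).2, mul_div_assoc]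

/-- The probability that the branch of a node at distance `d + 1` has more than half of `n` nodes. -/
noncomputable def branchTail (d n : ℕ) : ℝ := ∑ x ∈ Finset.Ioc (n / 2) n, branchLaw d n x

theorem sum_Ioc_sum_Ioc (f : ℕ → ℝ) (h n : ℕ) :
    ∑ y ∈ Finset.Ioc h n, ∑ x ∈ Finset.Ioc y n, f x =
      ∑ x ∈ Finset.Ioc h n, ((x : ℝ) - (h + 1)) * f x := by
  rw [Finset.sum_comm' (t' := Finset.Ioc h n) (s' := fun x => Finset.Ioo h x)]
  · refine Finset.sum_congr rfl fun x hx => ?_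
    rw [Finset.sum_const, Nat.card_Ioo, nsmul_eq_mul, Nat.sub_sub,
      Nat.cast_sub (Finset.mem_Ioc.mp hx).1]
    push_cast
    rfl
  · intro x y
    simp only [Finset.mem_Ioc, Finset.mem_Ioo]
    lia

/-- With h = n / 2, exchanging the sums gives each x > h the weight (x - h - 1)/x = 1 - (h + 1)/x.
-/
theorem branchTail_succ (d n : ℕ) :
    branchTail (d + 1) n =
      branchTail d n - ((n / 2 : ℕ) + 1) * branchLaw (d + 1) n (n / 2) := by
  rw [branchTail]
  simp only [branchLaw]
  rw [sum_Ioc_sum_Ioc, branchTail, Finset.mul_sum, ← Finset.sum_sub_distrib]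
  refine Finset.sum_congr rfl fun x hx => ?_
  have : (0 : ℝ) < x := by exact_mod_cast (Nat.zero_le _).trans_lt (Finset.mem_Ioc.mp hx).1
  field_simp

theorem branchTail_zero {n : ℕ} (hn : 1 ≤ n) :
    branchTail 0 n = ((n : ℝ) - (n / 2 : ℕ)) * ((n : ℝ) - (n / 2 : ℕ) - 1) / (n * (n + 1)) := by
  have hn0 : (0 : ℝ) < n := by exact_mod_cast hn
  have key : ∀ h k : ℕ, ∀ m : ℝ, ∑ x ∈ Finset.Ioc h (h + k), 2 * (m - x) =
      k * (2 * m - 2 * h - k - 1) := by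
    intro h k m
    induction k with
    | zero => simp
    | succ k ih =>
      rw [← add_assoc, Finset.sum_Ioc_succ_top (by lia), ih]
      push_cast
      ring
  simp only [branchTail, branchLaw]
  rw [← Finset.sum_div]
  congr 1
  have h := key (n / 2) (n - n / 2) n
  rw [Nat.add_sub_cancel' (Nat.div_le_self n 2)] at h
  rw [h, Nat.cast_sub (Nat.div_le_self n 2)]
  ring

/-! ### Nested harmonic sums -/

/-- This bound and the next one are mean value bounds for t ↦ t^(d + 1). They compare a sum of H^d/x
with a telescoping sum, where H is the harmonic tail. -/
theorem mul_pow_mul_sub_le (d : ℕ) {a b : ℝ} (ha : 0 ≤ a) (hab : a ≤ b) :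
    (d + 1) * a ^ d * (b - a) ≤ b ^ (d + 1) - a ^ (d + 1) := by
  induction d with
  | zero => simp
  | succ d ih =>
    have h1 := mul_le_mul_of_nonneg_left ih ha
    have h2 : 0 ≤ (b - a) * (b ^ (d + 1) - a ^ (d + 1)) :=
      mul_nonneg (by linarith) (by linarith [pow_le_pow_left₀ ha hab (d + 1)])
    push_cast
    have e1 : b ^ (d + 1 + 1) - a ^ (d + 1 + 1) = a * (b ^ (d + 1) - a ^ (d + 1)) +
      (b - a) * (b ^ (d + 1) - a ^ (d + 1)) + a ^ (d + 1) * (b - a) := by ring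
    have e2 : ((d : ℝ) + 1 + 1) * a ^ (d + 1) * (b - a) =
      a * ((d + 1) * a ^ d * (b - a)) + a ^ (d + 1) * (b - a) := by ring
    linarith

theorem le_mul_pow_mul_sub (d : ℕ) {a b : ℝ} (ha : 0 ≤ a) (hab : a ≤ b) :
    b ^ (d + 1) - a ^ (d + 1) ≤ (d + 1) * b ^ d * (b - a) := by
  induction d with
  | zero => simp
  | succ d ih =>
    have h1 := mul_le_mul_of_nonneg_left ih (ha.trans hab)
    have h2 : 0 ≤ (b - a) * (b ^ (d + 1) - a ^ (d + 1)) :=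
      mul_nonneg (by linarith) (by linarith [pow_le_pow_left₀ ha hab (d + 1)])
    push_cast
    have e1 : b ^ (d + 1 + 1) - a ^ (d + 1 + 1) = b * (b ^ (d + 1) - a ^ (d + 1)) +
      b ^ (d + 1) * (b - a) - (b - a) * (b ^ (d + 1) - a ^ (d + 1)) := by ring
    have e2 : ((d : ℝ) + 1 + 1) * b ^ (d + 1) * (b - a) =
      b * ((d + 1) * b ^ d * (b - a)) + b ^ (d + 1) * (b - a) := by ring
    linarith

theorem sum_Ioc_sub_telescope (f : ℕ → ℝ) {y n : ℕ} (h : y ≤ n) :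
    ∑ x ∈ Finset.Ioc y n, (f (x - 1) - f x) = f y - f n := by
  induction n, h using Nat.le_induction with
  | base => simp
  | succ n hn ih => rw [Finset.sum_Ioc_succ_top hn, ih, Nat.add_sub_cancel]; ring

/-- The sum of `1 / x` over `y < x ≤ n`. -/
noncomputable def harmonicTail (n y : ℕ) : ℝ := ∑ x ∈ Finset.Ioc y n, (1 : ℝ) / x

theorem harmonicTail_pred {n x : ℕ} (hx : 1 ≤ x) (hxn : x ≤ n) :
    harmonicTail n (x - 1) = harmonicTail n x + 1 / x := by
  obtain ⟨x, rfl⟩ := Nat.exists_eq_add_of_le' hx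
  rw [Nat.add_sub_cancel, harmonicTail, harmonicTail,
    ← Finset.sum_Ioc_consecutive (fun x : ℕ => (1 : ℝ) / x) (Nat.le_succ x) hxn]
  rw [Finset.sum_Ioc_succ_top le_rfl, Finset.Ioc_self, Finset.sum_empty, zero_add, add_comm]

theorem harmonicTail_nonneg (n y : ℕ) : 0 ≤ harmonicTail n y :=
  Finset.sum_nonneg fun _ _ => by positivity

theorem harmonicTail_self (n : ℕ) : harmonicTail n n = 0 := by simp [harmonicTail]

theorem nestedSum_le (d : ℕ) {n y : ℕ} (hy : y ≤ n) :
    nestedSum d n y ≤ harmonicTail n y ^ d / d.factorial := by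
  induction d generalizing y with
  | zero => simp [nestedSum]
  | succ d ih =>
    have hf : (0 : ℝ) < d.factorial := by exact_mod_cast d.factorial_pos
    have h1 : ∀ x ∈ Finset.Ioc y n, nestedSum d n x / x ≤
        harmonicTail n (x - 1) ^ (d + 1) / (d + 1).factorial -
          harmonicTail n x ^ (d + 1) / (d + 1).factorial := by
      intro x hx
      obtain ⟨hx1, hx2⟩ := Finset.mem_Ioc.mp hx
      have hx0 : (0 : ℝ) < x := by exact_mod_cast (Nat.zero_le _).trans_lt hx1
      refine (div_le_div_of_nonneg_right (ih hx2) hx0.le).trans ?_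
      have hpred := harmonicTail_pred (n := n) (x := x) (by lia) hx2
      have hpos : (0 : ℝ) ≤ 1 / x := by positivity
      have h2 := mul_pow_mul_sub_le d (harmonicTail_nonneg n x)
        (show harmonicTail n x ≤ harmonicTail n (x - 1) by linarith)
      rw [show harmonicTail n (x - 1) - harmonicTail n x = 1 / x by linarith] at h2
      rw [Nat.factorial_succ, ← sub_div]
      push_cast
      rw [div_div, div_le_div_iff₀ (by positivity) (by positivity)]
      rw [mul_one_div, div_le_iff₀ hx0] at h2
      nlinarith [mul_le_mul_of_nonneg_right h2 hf.le]
    refine (Finset.sum_le_sum h1).trans ?_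
    rw [sum_Ioc_sub_telescope (fun x => harmonicTail n x ^ (d + 1) / (d + 1).factorial) hy,
      harmonicTail_self]
    simp

/-- Each level of nesting loses at most one increment 1/x ≤ 1/(h + 1) of the harmonic tail, hence
the shift by d/(h + 1). Truncation at 0 keeps the powers monotone. -/
theorem le_nestedSum (d : ℕ) {h n y : ℕ} (hy : h ≤ y) (hyn : y ≤ n) :
    max (harmonicTail n y - d * (1 / (h + 1))) 0 ^ d / d.factorial ≤ nestedSum d n y := by
  induction d generalizing y with
  | zero => simp [nestedSum]
  | succ d ih =>
    set δ : ℝ := 1 / (h + 1) with hδ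
    have hδ0 : 0 < δ := by positivity
    have hf : (0 : ℝ) < d.factorial := by exact_mod_cast d.factorial_pos
    set g : ℕ → ℝ := fun x => max (harmonicTail n x - (d + 1 : ℕ) * δ) 0 with hg
    have hg0 : ∀ x, 0 ≤ g x := fun x => le_max_right _ _
    have h1 : ∀ x ∈ Finset.Ioc y n, g (x - 1) ^ (d + 1) / (d + 1).factorial -
          g x ^ (d + 1) / (d + 1).factorial ≤ nestedSum d n x / x := by
      intro x hx
      obtain ⟨hx1, hx2⟩ := Finset.mem_Ioc.mp hx
      have hx0 : (0 : ℝ) < x := by exact_mod_cast (Nat.zero_le _).trans_lt hx1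
      refine le_trans ?_ (div_le_div_of_nonneg_right (ih (hy.trans hx1.le) hx2) hx0.le)
      have hpred := harmonicTail_pred (n := n) (x := x) (by lia) hx2
      have hpos : (0 : ℝ) ≤ 1 / x := by positivity
      have hxδ : (1 : ℝ) / x ≤ δ := by
        rw [hδ]
        refine one_div_le_one_div_of_le (by positivity) ?_
        exact_mod_cast hy.trans_lt hx1
      have hle : g x ≤ g (x - 1) := max_le_max (by rw [hpred]; linarith) le_rfl
      have hsub : g (x - 1) - g x ≤ 1 / x := by
        rw [sub_le_iff_le_add]
        refine max_le ?_ (add_nonneg hpos (hg0 x))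
        have : harmonicTail n x - (d + 1 : ℕ) * δ ≤ g x := le_max_left _ _
        rw [hpred]; linarith
      -- The extra `δ` in `g` pays for the step from `x` to `x - 1`.
      have hup : g (x - 1) ≤ max (harmonicTail n x - d * δ) 0 := by
        refine max_le_max ?_ le_rfl
        rw [hpred]; push_cast; linarith
      have h2 := le_mul_pow_mul_sub d (hg0 x) hle
      have h3 : (d + 1 : ℝ) * g (x - 1) ^ d * (g (x - 1) - g x) ≤
          (d + 1) * max (harmonicTail n x - d * δ) 0 ^ d * (1 / x) := by
        have := pow_le_pow_left₀ (hg0 (x - 1)) hup d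
        have h4 := pow_nonneg (hg0 (x - 1)) d
        have h5 : (0 : ℝ) ≤ g (x - 1) - g x := by linarith
        gcongr
      have h4 := h2.trans h3
      rw [Nat.factorial_succ, ← sub_div]
      push_cast
      rw [div_div, div_le_div_iff₀ (by positivity) (by positivity)]
      rw [mul_one_div, le_div_iff₀ hx0] at h4
      nlinarith [mul_le_mul_of_nonneg_right h4 hf.le]
    refine le_trans (le_of_eq ?_) (Finset.sum_le_sum h1)
    rw [sum_Ioc_sub_telescope (fun x => g x ^ (d + 1) / (d + 1).factorial) hyn]
    have : g n = 0 := by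
      rw [hg]
      simp only [harmonicTail_self, zero_sub]
      exact max_eq_right (neg_nonpos.mpr (by positivity))
    rw [this, zero_pow (Nat.succ_ne_zero d), zero_div, sub_zero]

theorem tendsto_half_div : Tendsto (fun n : ℕ => ((n / 2 : ℕ) : ℝ) / n) atTop (𝓝 (1 / 2)) := by
  have h1 : Tendsto (fun n : ℕ => (1 : ℝ) / 2 - 1 / n) atTop (𝓝 (1 / 2)) := by
    simpa using tendsto_const_nhds.sub (tendsto_one_div_atTop_nhds_zero_nat (𝕜 := ℝ))
  refine tendsto_of_tendsto_of_tendsto_of_le_of_le' h1 tendsto_const_nhds ?_ ?_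
  · filter_upwards [eventually_gt_atTop 0] with n hn
    have hn0 : (0 : ℝ) < n := by exact_mod_cast hn
    have : (n : ℝ) ≤ 2 * (n / 2 : ℕ) + 1 := by exact_mod_cast (by lia : n ≤ 2 * (n / 2) + 1)
    rw [le_div_iff₀ hn0, sub_mul, one_div_mul_cancel hn0.ne']
    linarith
  · filter_upwards [eventually_gt_atTop 0] with n hn
    have hn0 : (0 : ℝ) < n := by exact_mod_cast hn
    have : (2 : ℝ) * (n / 2 : ℕ) ≤ n := by exact_mod_cast (by lia : 2 * (n / 2) ≤ n)
    rw [div_le_iff₀ hn0]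
    linarith

theorem tendsto_half : Tendsto (fun n : ℕ => n / 2) atTop atTop :=
  Nat.tendsto_div_const_atTop two_ne_zero

theorem harmonicTail_eq {n y : ℕ} (h : y ≤ n) :
    harmonicTail n y = (harmonic n : ℝ) - harmonic y := by
  induction n, h using Nat.le_induction with
  | base => simp [harmonicTail]
  | succ n hn ih =>
    rw [harmonicTail, Finset.sum_Ioc_succ_top hn, ← harmonicTail, ih, harmonic_succ]
    push_cast
    rw [one_div]
    ring

theorem tendsto_harmonicTail_half :
    Tendsto (fun n : ℕ => harmonicTail n (n / 2)) atTop (𝓝 (Real.log 2)) := by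
  have h1 := Real.tendsto_harmonic_sub_log
  have h2 := h1.comp tendsto_half
  have h3 : Tendsto (fun n : ℕ => -Real.log (((n / 2 : ℕ) : ℝ) / n)) atTop (𝓝 (Real.log 2)) := by
    have := ((Real.continuousAt_log (by norm_num : (1 / 2 : ℝ) ≠ 0)).tendsto.comp
      tendsto_half_div).neg
    simpa using this
  -- The Euler–Mascheroni constants cancel.
  have h4 := (h1.sub h2).add h3
  rw [sub_self, zero_add] at h4
  refine h4.congr' ?_
  filter_upwards [eventually_ge_atTop 2] with n hn
  have hn0 : ((n : ℕ) : ℝ) ≠ 0 := by exact_mod_cast (by lia : n ≠ 0)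
  have hh0 : ((n / 2 : ℕ) : ℝ) ≠ 0 := by exact_mod_cast (by lia : n / 2 ≠ 0)
  rw [harmonicTail_eq (Nat.div_le_self n 2), Real.log_div hh0 hn0]
  simp only [Function.comp_apply]
  ring

theorem tendsto_nestedSum_half (d : ℕ) :
    Tendsto (fun n : ℕ => nestedSum d n (n / 2)) atTop (𝓝 (Real.log 2 ^ d / d.factorial)) := by
  have h1 := tendsto_harmonicTail_half
  have hδ : Tendsto (fun n : ℕ => (d : ℝ) * (1 / (((n / 2 : ℕ) : ℝ) + 1))) atTop (𝓝 0) := by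
    have := (tendsto_one_div_add_atTop_nhds_zero_nat (𝕜 := ℝ)).comp tendsto_half
    simpa using this.const_mul (d : ℝ)
  have h2 : Tendsto (fun n : ℕ => max (harmonicTail n (n / 2) -
      (d : ℝ) * (1 / (((n / 2 : ℕ) : ℝ) + 1))) 0 ^ d / d.factorial) atTop
      (𝓝 (Real.log 2 ^ d / d.factorial)) := by
    have := (((h1.sub hδ).max (tendsto_const_nhds (x := (0 : ℝ)))).pow d).div_const
      (d.factorial : ℝ)
    rwa [sub_zero, max_eq_left (Real.log_nonneg one_le_two)] at this
  exact tendsto_of_tendsto_of_tendsto_of_le_of_le h2 ((h1.pow d).div_const _)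
    (fun n => le_nestedSum d le_rfl (Nat.div_le_self n 2))
    (fun n => nestedSum_le d (Nat.div_le_self n 2))

/-- The limit of `n / 2` times the probability that the branch of a node at distance `d + 1` has
`n / 2` nodes. -/
noncomputable def midLimit : ℕ → ℝ
  | 0 => 1 / 2
  | d + 1 => Real.log 2 ^ (d + 1) / (d + 1).factorial - midLimit d

/-- The limit of the probability that the branch of a node at distance `d + 1` has more than half
of the nodes. -/
noncomputable def tailLimit : ℕ → ℝ
  | 0 => 1 / 4
  | d + 1 => tailLimit d - midLimit (d + 1)

theorem tendsto_half_add_one_div :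
    Tendsto (fun n : ℕ => (((n / 2 : ℕ) : ℝ) + 1) * (2 / ((n : ℝ) + 1))) atTop (𝓝 1) := by
  have h1 : Tendsto (fun n : ℕ => (1 : ℝ) / n) atTop (𝓝 0) := tendsto_one_div_atTop_nhds_zero_nat
  have h2 := ((tendsto_half_div.add h1).mul_const 2).div (tendsto_const_nhds.add h1)
    (by norm_num : (1 : ℝ) + 0 ≠ 0)
  norm_num at h2
  refine h2.congr' ?_
  filter_upwards [eventually_gt_atTop 0] with n hn
  have hn0 : (0 : ℝ) < n := by exact_mod_cast hn
  simp only [Pi.div_apply]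
  field_simp

theorem tendsto_branchLaw_half (d : ℕ) :
    Tendsto (fun n : ℕ => (((n / 2 : ℕ) : ℝ) + 1) * branchLaw d n (n / 2)) atTop
      (𝓝 (midLimit d)) := by
  induction d with
  | zero =>
    have h1 := tendsto_half_add_one_div.mul
      ((tendsto_const_nhds (x := (1 : ℝ))).sub tendsto_half_div)
    norm_num at h1
    rw [midLimit]
    refine Tendsto.congr' ?_ h1
    filter_upwards [eventually_gt_atTop 0] with n hn
    have hn0 : (0 : ℝ) < n := by exact_mod_cast hn
    rw [branchLaw]
    field_simp
  | succ d ih =>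
    have h1 := (tendsto_half_add_one_div.mul (tendsto_nestedSum_half (d + 1))).sub ih
    rw [one_mul] at h1
    refine h1.congr' ?_
    filter_upwards [eventually_gt_atTop 0] with n hn
    have := branchLaw_succ_add hn d (Nat.div_le_self n 2)
    rw [mul_assoc, ← this]
    ring

/-- Makes the undecided case of a branch with exactly half of the nodes negligible. -/
theorem tendsto_branchLaw_half_zero (d : ℕ) :
    Tendsto (fun n : ℕ => branchLaw d n (n / 2)) atTop (𝓝 0) := by
  have h1 := (tendsto_one_div_add_atTop_nhds_zero_nat (𝕜 := ℝ)).comp tendsto_half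
  have h2 := h1.mul (tendsto_branchLaw_half d)
  rw [zero_mul] at h2
  refine h2.congr fun n => ?_
  have : (0 : ℝ) < ((n / 2 : ℕ) : ℝ) + 1 := by positivity
  simp only [Function.comp_apply]
  field_simp

theorem tendsto_branchTail (d : ℕ) :
    Tendsto (fun n : ℕ => branchTail d n) atTop (𝓝 (tailLimit d)) := by
  induction d with
  | zero =>
    have h1 : Tendsto (fun n : ℕ => (1 : ℝ) / n) atTop (𝓝 0) :=
      tendsto_one_div_atTop_nhds_zero_nat
    have h2 := (tendsto_const_nhds (x := (1 : ℝ))).sub tendsto_half_div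
    have h3 := (h2.mul (h2.sub h1)).div ((tendsto_const_nhds (x := (1 : ℝ))).add h1)
      (by norm_num)
    norm_num at h3
    rw [tailLimit]
    refine Tendsto.congr' ?_ h3
    filter_upwards [eventually_gt_atTop 0] with n hn
    have hn0 : (0 : ℝ) < n := by exact_mod_cast hn
    rw [branchTail_zero hn]
    simp only [Pi.div_apply]
    field_simp
  | succ d ih =>
    rw [tailLimit]
    refine (ih.sub (tendsto_branchLaw_half (d + 1))).congr fun n => ?_
    rw [branchTail_succ]

/-- Raising `k` by one subtracts `midLimit (k + 2) + midLimit (k + 1)`, a single term of the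
exponential series at ln 2. -/
theorem tailLimit_succ_add (k : ℕ) : tailLimit (k + 1) + tailLimit k =
    2 - ∑ m ∈ Finset.range (k + 2), Real.log 2 ^ m / (m.factorial : ℝ) := by
  induction k with
  | zero =>
    simp [tailLimit, midLimit, Finset.sum_range_succ]
    ring
  | succ k ih =>
    rw [Finset.sum_range_succ, ← sub_sub, ← ih, tailLimit, midLimit]
    simp only [tailLimit]
    ring

/-- By `tailLimit_succ_add`, the left sides for `k` and `k + 1` add up to the bracket with l = k +
2; alternating summation gives the formula. -/
theorem tailLimit_sub (k : ℕ) : tailLimit k - 2 * tailLimit (k + 1) = (-1 : ℝ) ^ (k + 1) *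
    (1 / 4 + ∑ l ∈ Finset.Icc 1 (k + 1), (-1 : ℝ) ^ l * (Real.log 2 ^ l / (l.factorial : ℝ) - 2
      + ∑ m ∈ Finset.range (l + 1), Real.log 2 ^ m / (m.factorial : ℝ))) := by
  induction k with
  | zero =>
    simp [tailLimit, midLimit, Finset.sum_range_succ]
    ring
  | succ k ih =>
    have h1 := tailLimit_succ_add k
    have h2 := tailLimit_succ_add (k + 1)
    have h3 : ((-1 : ℝ) ^ (k + 1)) * (-1) ^ (k + 1) = 1 := by
      rw [← mul_pow]; norm_num
    rw [Finset.sum_range_succ] at h2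
    rw [Finset.sum_Icc_succ_top (by lia), Finset.sum_range_succ _ (k + 1 + 1)]
    set E := ∑ m ∈ Finset.range (k + 2), Real.log 2 ^ m / (m.factorial : ℝ)
    set Z := ∑ l ∈ Finset.Icc 1 (k + 1), (-1 : ℝ) ^ l * (Real.log 2 ^ l / (l.factorial : ℝ) - 2
      + ∑ m ∈ Finset.range (l + 1), Real.log 2 ^ m / (m.factorial : ℝ))
    set s := (-1 : ℝ) ^ (k + 1) with hs
    have h4 : (-1 : ℝ) ^ (k + 1 + 1) = -s := by rw [pow_succ, hs]; ring
    rw [h4]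
    linear_combination -ih + h1 - 2 * h2 - (Real.log 2 ^ (k + 1 + 1) / ((k + 1 + 1).factorial : ℝ) -
      2 + (E + Real.log 2 ^ (k + 1 + 1) / ((k + 1 + 1).factorial : ℝ))) * h3

end Asymptotics

/-! ### Law of the estimation error -/

section Limit

variable {V : Type*} {G : SimpleGraph V} {Ω : Type*} [MeasurableSpace Ω] {P : Measure Ω}
  {τ : G.edgeSet → Ω → ℝ} [G.LocallyFinite] [DecidableEq V] [Countable V] [IsProbabilityMeasure P]

/-- Conditioning on the size x of the parent's branch: since y ≥ 1, it satisfies x > y, and the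
conditional law is uniform with weight 1/x. For y = 0 an empty parent's branch would contribute as
well. -/
theorem networkProb_branchCard (hG : G.IsTree) (hdeg : G.IsRegularOfDegree 3)
    (hτ : ∀ e, Measurable (τ e)) (hind : iIndepFun τ P)
    (hlaw : ∀ e, P.map (τ e) = expMeasure 1) {s : V} {n : ℕ} (hn : 1 ≤ n) (d : ℕ) {v : V}
    (hv : G.dist s v = d + 1) {y : ℕ} (hy1 : 1 ≤ y) (hyn : y ≤ n) :
    networkProb P τ s n (fun A => branchCard G s v A = y) = branchLaw d n y := by
  induction d generalizing v y with
  | zero =>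
    exact networkProb_branchCard_of_adj hG hdeg hτ hind hlaw
      (SimpleGraph.dist_eq_one_iff_adj.mp hv) hn hyn
  | succ d ih =>
    have hvs : v ≠ s := by
      rintro rfl
      rw [SimpleGraph.dist_self] at hv
      lia
    have hu : G.dist s (parent G s v) = d + 1 := by
      have := dist_parent hG hvs
      lia
    have hus : parent G s v ≠ s := by
      intro h
      rw [h, SimpleGraph.dist_self] at hu
      lia
    rw [networkProb_fiber hG hdeg hτ hind hlaw hn (branchCard G s (parent G s v))
      (Finset.Ioc y n)]
    · rw [branchLaw]
      refine Finset.sum_congr rfl fun x hx => ?_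
      obtain ⟨hyx, hxn⟩ := Finset.mem_Ioc.mp hx
      have hx0 : (x : ℝ) ≠ 0 := by exact_mod_cast (by lia : x ≠ 0)
      rw [← ih hu (by lia) hxn, eq_div_iff hx0, mul_comm]
      exact networkProb_branchCard_pair hG hdeg hτ hind hlaw hvs hus hn hyx
    · intro A hA hAn hAy
      have h1 := branchCard_le_parent hG s v A
      have h2 := hA.branchCard_lt_parent hG hvs (by lia)
      have h3 := branchCard_le_card (G := G) s (parent G s v) A
      exact Finset.mem_Ioc.mpr ⟨by lia, by lia⟩

theorem networkProb_lt_branchCard (hG : G.IsTree) (hdeg : G.IsRegularOfDegree 3)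
    (hτ : ∀ e, Measurable (τ e)) (hind : iIndepFun τ P)
    (hlaw : ∀ e, P.map (τ e) = expMeasure 1) {s : V} {n : ℕ} (hn : 1 ≤ n) (d : ℕ) {v : V}
    (hv : G.dist s v = d + 1) :
    networkProb P τ s n (fun A => n < 2 * branchCard G s v A) = branchTail d n := by
  rw [networkProb_fiber hG hdeg hτ hind hlaw hn (branchCard G s v) (Finset.Ioc (n / 2) n)]
  · rw [branchTail]
    refine Finset.sum_congr rfl fun y hy => ?_
    obtain ⟨hy1, hyn⟩ := Finset.mem_Ioc.mp hy
    rw [← networkProb_branchCard hG hdeg hτ hind hlaw hn d hv (by lia) hyn]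
    exact networkProb_congr hG hdeg hτ hind hlaw hn fun A _ _ => by lia
  · intro A _ hAn h
    have := branchCard_le_card (G := G) s v A
    exact Finset.mem_Ioc.mpr ⟨by lia, by lia⟩

theorem networkProb_le_branchCard (hG : G.IsTree) (hdeg : G.IsRegularOfDegree 3)
    (hτ : ∀ e, Measurable (τ e)) (hind : iIndepFun τ P)
    (hlaw : ∀ e, P.map (τ e) = expMeasure 1) {s : V} {n : ℕ} (hn : 2 ≤ n) (d : ℕ) {v : V}
    (hv : G.dist s v = d + 1) :
    networkProb P τ s n (fun A => n ≤ 2 * branchCard G s v A) ≤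
      branchTail d n + branchLaw d n (n / 2) := by
  rw [← networkProb_lt_branchCard hG hdeg hτ hind hlaw (by lia) d hv,
    ← networkProb_branchCard hG hdeg hτ hind hlaw (by lia) d hv (y := n / 2) (by lia) (by lia),
    networkProb_eq_measureReal hG hdeg hτ hind hlaw s (by lia),
    networkProb_eq_measureReal hG hdeg hτ hind hlaw s (by lia),
    networkProb_eq_measureReal hG hdeg hτ hind hlaw s (by lia)]
  refine (measureReal_mono ?_).trans (measureReal_union_le _ _)
  rintro ω ⟨A, h, hA⟩
  by_cases h1 : n < 2 * branchCard G s v A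
  · exact Or.inl ⟨A, h1, hA⟩
  · exact Or.inr ⟨A, by lia, hA⟩

omit [G.LocallyFinite] [DecidableEq V] [IsProbabilityMeasure P] in
theorem measurableSet_estimate_mem {s : V} {n : ℕ} {W : Ω → V}
    (hW : IsMLEstimate P τ s n W) (B : Set V) : MeasurableSet {ω | W ω ∈ B} := by
  have : {ω | W ω ∈ B} = ⋃ v ∈ B, {ω | W ω = v} := by
    ext ω
    simp
  rw [this]
  exact MeasurableSet.biUnion B.to_countable fun v _ => hW.measurableSet_fiber v

theorem le_measure_mem_branch (hG : G.IsTree) (hdeg : G.IsRegularOfDegree 3)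
    (hτ : ∀ e, Measurable (τ e)) (hind : iIndepFun τ P)
    (hlaw : ∀ e, P.map (τ e) = expMeasure 1) {s v : V} {n : ℕ} (hn : 1 ≤ n) {W : Ω → V}
    (hW : IsMLEstimate P τ s n W) :
    networkProb P τ s n (fun A => n < 2 * branchCard G s v A) ≤
      P.real {ω | W ω ∈ branch G s v} := by
  rw [networkProb_eq_measureReal hG hdeg hτ hind hlaw s hn]
  refine ENNReal.toReal_mono (measure_ne_top _ _) (measure_mono_ae ?_)
  filter_upwards [ae_mem_mlCandidates hG hdeg hτ hind hlaw hn hW] with ω ⟨A, hA, hAn, hω, h0, hc⟩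
  rintro ⟨B, hB, hωB⟩
  by_cases hAB : A = B
  · subst hAB
    exact mem_branch_of_mem_mlCandidates hG hdeg hτ hind hlaw hn hA hAn h0 hc hB
  · exact (Set.disjoint_left.mp (observedEvent_disjoint τ s n hAB) hω hωB).elim

theorem measure_mem_branch_le (hG : G.IsTree) (hdeg : G.IsRegularOfDegree 3)
    (hτ : ∀ e, Measurable (τ e)) (hind : iIndepFun τ P)
    (hlaw : ∀ e, P.map (τ e) = expMeasure 1) {s v : V} (hvs : v ≠ s) {n : ℕ} (hn : 1 ≤ n)
    {W : Ω → V} (hW : IsMLEstimate P τ s n W) :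
    P.real {ω | W ω ∈ branch G s v} ≤
      networkProb P τ s n (fun A => n ≤ 2 * branchCard G s v A) := by
  rw [networkProb_eq_measureReal hG hdeg hτ hind hlaw s hn]
  refine ENNReal.toReal_mono (measure_ne_top _ _) (measure_mono_ae ?_)
  filter_upwards [ae_mem_mlCandidates hG hdeg hτ hind hlaw hn hW] with ω ⟨A, hA, hAn, hω, h0, hc⟩
  intro h
  exact ⟨A, le_card_branch_of_mem_mlCandidates hG hdeg hτ hind hlaw hvs hn hA hAn h0 hc h, hω⟩

theorem tendsto_measure_mem_branch (hG : G.IsTree) (hdeg : G.IsRegularOfDegree 3)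
    (hτ : ∀ e, Measurable (τ e)) (hind : iIndepFun τ P)
    (hlaw : ∀ e, P.map (τ e) = expMeasure 1) {s : V} {W : ℕ → Ω → V}
    (hW : ∀ n, 1 ≤ n → IsMLEstimate P τ s n (W n)) (d : ℕ) {v : V} (hv : G.dist s v = d + 1) :
    Tendsto (fun n => P.real {ω | W n ω ∈ branch G s v}) atTop (𝓝 (tailLimit d)) := by
  have hvs : v ≠ s := by
    rintro rfl
    rw [SimpleGraph.dist_self] at hv
    lia
  have h1 := tendsto_branchTail d
  have h2 := h1.add (tendsto_branchLaw_half_zero d)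
  rw [add_zero] at h2
  refine tendsto_of_tendsto_of_tendsto_of_le_of_le' h1 h2 ?_ ?_
  · filter_upwards [eventually_ge_atTop 1] with n hn
    rw [← networkProb_lt_branchCard hG hdeg hτ hind hlaw hn d hv]
    exact le_measure_mem_branch hG hdeg hτ hind hlaw hn (hW n hn)
  · filter_upwards [eventually_ge_atTop 2] with n hn
    exact (measure_mem_branch_le hG hdeg hτ hind hlaw hvs (by lia) (hW n (by lia))).trans
      (networkProb_le_branchCard hG hdeg hτ hind hlaw hn d hv)

/-- The nodes farther than `d` from `s` form the disjoint union of the branches of the 3·2^d nodes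
at distance `d + 1`, and all these branches have the same limit. -/
theorem tendsto_measure_lt_dist (hG : G.IsTree) (hdeg : G.IsRegularOfDegree 3)
    (hτ : ∀ e, Measurable (τ e)) (hind : iIndepFun τ P)
    (hlaw : ∀ e, P.map (τ e) = expMeasure 1) {s : V} {W : ℕ → Ω → V}
    (hW : ∀ n, 1 ≤ n → IsMLEstimate P τ s n (W n)) (d : ℕ) :
    Tendsto (fun n => P.real {ω | d < G.dist s (W n ω)}) atTop
      (𝓝 (3 * 2 ^ d * tailLimit d)) := by
  obtain ⟨S, hS, hcard⟩ := exists_sphere hG hdeg s d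
  have h1 : Tendsto (fun n => ∑ v ∈ S, P.real {ω | W n ω ∈ branch G s v}) atTop
      (𝓝 (∑ v ∈ S, tailLimit d)) :=
    tendsto_finsetSum _ fun v hv =>
      tendsto_measure_mem_branch hG hdeg hτ hind hlaw hW d ((hS v).mp hv)
  rw [Finset.sum_const, hcard, nsmul_eq_mul] at h1
  push_cast at h1
  refine h1.congr' ?_
  filter_upwards [eventually_ge_atTop 1] with n hn
  have hU : {ω | d < G.dist s (W n ω)} = ⋃ v ∈ S, {ω | W n ω ∈ branch G s v} := by
    ext ω
    simp only [Set.mem_iUnion, exists_prop, Set.mem_ofPred_eq]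
    constructor
    · intro h
      obtain ⟨v, hv, hx⟩ := exists_mem_branch_of_le_dist hG (Nat.succ_le_of_lt h)
      exact ⟨v, (hS v).mpr hv, hx⟩
    · rintro ⟨v, hv, hx⟩
      have h2 := (hS v).mp hv
      have h3 : G.dist s (W n ω) = G.dist s v + G.dist v (W n ω) := hx
      lia
  rw [hU, measureReal_biUnion_finset]
  · intro v hv w hw hvw
    have := branch_disjoint hG hvw (((hS v).mp hv).trans ((hS w).mp hw).symm)
    exact Set.disjoint_left.mpr fun ω h2 h3 => Set.disjoint_left.mp this h2 h3
  · exact fun v _ => measurableSet_estimate_mem (hW n hn) _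

end Limit

end Rumor

theorem theorem2 {V : Type*} [Countable V] (G : SimpleGraph V) [G.LocallyFinite]
    (hG : G.IsTree) (hdeg : G.IsRegularOfDegree 3)
    {Ω : Type*} [MeasurableSpace Ω] (P : Measure Ω) [IsProbabilityMeasure P]
    (τ : G.edgeSet → Ω → ℝ) (hτ_meas : ∀ e, Measurable (τ e))
    (hτ_indep : iIndepFun τ P) (hτ_law : ∀ e, P.map (τ e) = expMeasure 1)
    (s : V) (W : ℕ → Ω → V) (hW : ∀ n, 1 ≤ n → IsMLEstimate P τ s n (W n))
    (d : ℕ) (hd : 1 ≤ d) :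
    Tendsto (fun n : ℕ => P.real {ω | G.dist (W n ω) s = d}) atTop
      (𝓝 (3 * 2 ^ (d - 1) * (-1 : ℝ) ^ d *
        (1 / 4 + ∑ l ∈ Finset.Icc 1 d, (-1 : ℝ) ^ l *
          (Real.log 2 ^ l / (l.factorial : ℝ) - 2
            + ∑ m ∈ Finset.range (l + 1), Real.log 2 ^ m / (m.factorial : ℝ))))) := by
  classical
  obtain ⟨k, rfl⟩ := Nat.exists_eq_add_of_le' hd
  -- With `d = k + 1`, an error of exactly `d` is an error larger than `k` but not larger than `k +
  -- 1`.
  have h1 := (Rumor.tendsto_measure_lt_dist hG hdeg hτ_meas hτ_indep hτ_law hW k).sub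
    (Rumor.tendsto_measure_lt_dist hG hdeg hτ_meas hτ_indep hτ_law hW (k + 1))
  have h2 : 3 * 2 ^ k * Rumor.tailLimit k - 3 * 2 ^ (k + 1) * Rumor.tailLimit (k + 1) =
      3 * 2 ^ k * (Rumor.tailLimit k - 2 * Rumor.tailLimit (k + 1)) := by ring
  rw [h2, Rumor.tailLimit_sub, ← mul_assoc] at h1
  rw [Nat.add_sub_cancel]
  refine h1.congr' ?_
  filter_upwards [eventually_ge_atTop 1] with n hn
  have hm := Rumor.measurableSet_estimate_mem (hW n hn) {v | k + 1 < G.dist s v}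
  have hsub : {ω | k + 1 < G.dist s (W n ω)} ⊆ {ω | k < G.dist s (W n ω)} :=
    fun ω h => (Nat.lt_succ_self k).trans h
  rw [← measureReal_sdiff hsub hm]
  congr 1
  ext ω
  simp only [Set.mem_sdiff, Set.mem_ofPred_eq, SimpleGraph.dist_comm (v := s)]
  lia
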